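/- **Setting.** Let $\mathcal S,\mathcal A,\mathcal D$ be finite sets and $T\in\mathbb N$. Consider an MDP with transition probabilities $P(s'\mid s,a)$, initial state distribution $\eta$, episodes of $T$ steps and reward function $r(s,a)$. At step $t$ a noisy reward $\bar r_t\in[0,1]$ is generated whose law depends only on $(t,s_t,a_t)$ and has mean $r(s_t,a_t)$; given the trajectory, the rewards of different steps are independent. Let $\phi:\mathcal S\times\mathcal A\to\mathcal D$ be a surjective latent reward map such that $r(s,a)=f^*(\phi(s,a))$ for some $f^*:\mathcal D\to\mathbb R$; we also write $r\in\mathbb R^{|\mathcal D|}$ for $f^*$. Let $\Pi$ be a class of (possibly randomized and time-dependent) Markov policies. For a trajectory, let $\hat h^\phi(z)=\#\{t:\phi(s_t,a_t)=z\}$, $z\in\mathcal D$; for a policy $\pi$ let $h^\phi_\pi=\mathbb E_\pi[\hat h^\phi]\in\mathbb R^{|\mathcal D|}$, $V^{\phi,\pi}=r^\top h^\phi_\pi$ and $V^*=\sup_{\pi\in\Pi}\mathbb E_\pi\big[\sum_{t=1}^T r(s_t,a_t)\big]$. **Algorithm.** Fix $\delta\in(0,1)$ and $\lambda=T$. After each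 episode $k$, played with policy $\pi_k$, the learner, who knows $P$, $\eta$ and $\phi$, observes the trajectory (hence $\hat h^\phi_k$) and only the episodic return $R_k=\sum_{t=1}^T\bar r_t$. Put $$A^\phi_k=\sum_{l\le k}\hat h^\phi_l(\hat h^\phi_l)^\top+\lambda I,\qquad \hat r^\phi_k=(A^\phi_k)^{-1}\sum_{l\le k}\hat h^\phi_lR_l,\qquad l^\phi_k=\sqrt{\tfrac14T|\mathcal D|\log\frac{1+kT^2/\lambda}{\delta/10}}+\sqrt{\lambda|\mathcal D|},$$ and $\|x\|_M=\sqrt{x^\top Mx}$. In every episode $k\ge1$ the learner plays $$\pi_k\in\arg\max_{\pi\in\Pi}\Big((h^\phi_\pi)^\top\hat r^\phi_{k-1}+l^\phi_{k-1}\|h^\phi_\pi\|_{(A^\phi_{k-1})^{-1}}\Big).$$ **Proposition 2 (Tighter Regret Bound).** There is a universal constant $C>0$ such that, in every such setting and for every $\delta\in(0,1)$, with probability greater than $1-\delta$, simultaneously for all $K\in\mathbb N^+$ with $KT\ge2$, $$\rho^\phi(K)=\sum_{k=1}^K\big(V^*-V^{\phi,\pi_k}\big)\le C\,T|\mathcal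 D|\sqrt K\,\log\frac{KT}{\delta}.$$ If moreover $|\mathcal D|<|\mathcal S||\mathcal A|$, then for all $K$ with $KT\ge 2$ the right-hand side is strictly smaller than $C\,T|\mathcal S||\mathcal A|\sqrt K\,\log\frac{KT}{\delta}$, the bound obtained without the latent reward (the case $\mathcal D=\mathcal S\times\mathcal A$, $\phi=\mathrm{id}$). -/

import Mathlib

open MeasureTheory Matrix

noncomputable section

/-- A tabular finite-horizon MDP with episodes of `T` steps and stochastic rewards in `[0,1]`.
`reward` is the true (mean) reward function `r(s,a)`; `rewardLaw t s a` is the law of the noisy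
version of it that is generated at step `t`. -/
structure EpisodicMDP (S A : Type*) [Fintype S] [Fintype A] (T : ℕ) where
  /-- law of the first state of an episode -/
  init : S → ℝ
  init_mem : init ∈ stdSimplex ℝ S
  /-- `trans s a s' = P(s' | s, a)` -/
  trans : S → A → S → ℝ
  trans_mem : ∀ s a, trans s a ∈ stdSimplex ℝ S
  reward : S × A → ℝ
  rewardLaw : Fin T → S × A → Measure ℝ
  rewardLaw_prob : ∀ t x, IsProbabilityMeasure (rewardLaw t x)
  rewardLaw_Icc : ∀ t x, rewardLaw t x (Set.Icc 0 1)ᶜ = 0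
  rewardLaw_mean : ∀ t x, ∫ y, y ∂(rewardLaw t x) = reward x

/-- Randomized, possibly time-dependent, Markov policies: `p t s a` is the probability of playing
`a` in state `s` at step `t`. Stationary and deterministic policies are special cases. -/
abbrev PolicyFn (S A : Type*) (T : ℕ) := Fin T → S → A → ℝ

def IsPolicy {S A : Type*} [Fintype A] {T : ℕ} (p : PolicyFn S A T) : Prop :=
  ∀ t s, p t s ∈ stdSimplex ℝ A

/-- State-action trajectories of an episode. -/
abbrev Trajectory (S A : Type*) (T : ℕ) := Fin T → S × A

/-- Probability of the trajectory `x` when the policy `p` is played for one episode. -/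
def EpisodicMDP.trajProb {S A : Type*} [Fintype S] [Fintype A] {T : ℕ}
    (M : EpisodicMDP S A T) (p : PolicyFn S A T) (x : Trajectory S A T) : ℝ :=
  ∏ t : Fin T,
    (if (t : ℕ) = 0 then M.init (x t).1
      else M.trans (x ⟨(t : ℕ) - 1, by omega⟩).1 (x ⟨(t : ℕ) - 1, by omega⟩).2 (x t).1)
    * p t (x t).1 (x t).2

/-- Expected cumulative (true) reward of a policy over one episode. -/
def EpisodicMDP.value {S A : Type*} [Fintype S] [Fintype A] {T : ℕ}
    (M : EpisodicMDP S A T) (p : PolicyFn S A T) : ℝ :=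
  ∑ x : Trajectory S A T, M.trajProb p x * ∑ t, M.reward (x t)

/-- The optimal value `V*` over the policy class `Pol`. -/
def EpisodicMDP.optValue {S A : Type*} [Fintype S] [Fintype A] {T : ℕ}
    (M : EpisodicMDP S A T) (Pol : Set (PolicyFn S A T)) : ℝ :=
  sSup (M.value '' Pol)

/-- Empirical latent-reward frequency vector of a trajectory: the number of steps `t` at which the
latent reward `φ (s_t, a_t)` equals `z`. -/
def latentFreq {S A D : Type*} [DecidableEq D] {T : ℕ} (φ : S × A → D)
    (x : Trajectory S A T) : D → ℝ :=
  fun z => ∑ t, if φ (x t) = z then 1 else 0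

/-- Latent-reward occupancy vector of a policy: the expected latent-reward frequency vector. -/
def EpisodicMDP.latentOcc {S A D : Type*} [Fintype S] [Fintype A] [DecidableEq D] {T : ℕ}
    (M : EpisodicMDP S A T) (φ : S × A → D) (p : PolicyFn S A T) : D → ℝ :=
  ∑ x : Trajectory S A T, M.trajProb p x • latentFreq φ x

/-- `V^{φ,p}`, the inner product of the latent reward function `f` with the latent occupancy. -/
def EpisodicMDP.latentValue {S A D : Type*} [Fintype S] [Fintype A] [Fintype D] [DecidableEq D]
    {T : ℕ} (M : EpisodicMDP S A T) (φ : S × A → D) (f : D → ℝ) (p : PolicyFn S A T) : ℝ :=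
  f ⬝ᵥ M.latentOcc φ p

/-- The weighted norm `√(xᵀ M x)`. -/
def weightedNorm {D : Type*} [Fintype D] (M : Matrix D D ℝ) (x : D → ℝ) : ℝ :=
  √(x ⬝ᵥ M *ᵥ x)

/-- The matrix whose rows are the first `k` frequency vectors. -/
def designMatrix {D : Type*} (h : ℕ → D → ℝ) (k : ℕ) : Matrix (Fin k) D ℝ :=
  Matrix.of fun l z => h l z

/-- `HᵀH + lam I` after `k` episodes. -/
def regGram {D : Type*} [DecidableEq D] (lam : ℝ) (h : ℕ → D → ℝ) (k : ℕ) : Matrix D D ℝ :=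
  (designMatrix h k)ᵀ * designMatrix h k + lam • (1 : Matrix D D ℝ)

/-- Regularized least-squares estimate of the latent reward function from the frequency vectors
`h l` and the episodic returns `R l` of the first `k` episodes. -/
def ridgeEstimate {D : Type*} [Fintype D] [DecidableEq D] (lam : ℝ) (h : ℕ → D → ℝ) (R : ℕ → ℝ)
    (k : ℕ) : D → ℝ :=
  (regGram lam h k)⁻¹ *ᵥ ∑ l ∈ Finset.range k, R l • h l

/-- Confidence radius after `k` episodes of length `T`, in dimension `d`. -/
def confRadius (T d : ℕ) (lam δ : ℝ) (k : ℕ) : ℝ :=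
  √(1 / 4 * T * d * Real.log ((1 + k * (T : ℝ) ^ 2 / lam) / (δ / 10))) + √(lam * d)

/-- The optimistic objective that is maximized over policies after `k` observed episodes. -/
def EpisodicMDP.ofulObjective {S A D : Type*} [Fintype S] [Fintype A] [Fintype D] [DecidableEq D]
    {T : ℕ} (M : EpisodicMDP S A T) (φ : S × A → D) (lam δ : ℝ) (h : ℕ → D → ℝ) (R : ℕ → ℝ)
    (k : ℕ) (p : PolicyFn S A T) : ℝ :=
  M.latentOcc φ p ⬝ᵥ ridgeEstimate lam h R k
    + confRadius T (Fintype.card D) lam δ k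
      * weightedNorm (regGram lam h k)⁻¹ (M.latentOcc φ p)

/-- Law of the interaction of a learner with the MDP over an infinite sequence of episodes.
Episodes are numbered from `0`, and `F k` is the information available before episode `k`.
In episode `k` the policy `pol k` is played; given `F k`, the trajectory `traj k` is drawn from the
MDP under that policy, and given also the trajectory, the per-step noisy rewards `rew k t` are
independent with laws `rewardLaw t (s_t, a_t)`. -/
structure IsInteraction {S A : Type*} [Fintype S] [Fintype A] {T : ℕ} (M : EpisodicMDP S A T)
    {Ω : Type*} {mΩ : MeasurableSpace Ω} (μ : Measure Ω) (F : Filtration ℕ mΩ)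
    (pol : ℕ → Ω → PolicyFn S A T) (traj : ℕ → Ω → Trajectory S A T)
    (rew : ℕ → Ω → Fin T → ℝ) : Prop where
  isPolicy : ∀ k ω, IsPolicy (pol k ω)
  pol_meas : ∀ k, Measurable[F k] (pol k)
  traj_meas : ∀ k x, MeasurableSet[F (k + 1)] {ω | traj k ω = x}
  rew_meas : ∀ k, Measurable[F (k + 1)] (rew k)
  condLaw : ∀ k x (B : Set (Fin T → ℝ)), MeasurableSet B →
    μ[({ω | traj k ω = x ∧ rew k ω ∈ B}).indicator (fun _ => (1 : ℝ)) | F k] =ᵐ[μ]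
      fun ω => M.trajProb (pol k ω) x * (Measure.pi fun t => M.rewardLaw t (x t)).real B

/-- The learner observes of each past episode only its trajectory and its episodic return
`∑ t, rew k t`, and plays in every episode a maximizer over the policy class `Pol` of the optimistic
objective. -/
def IsOFUL {S A D : Type*} [Fintype S] [Fintype A] [Fintype D] [DecidableEq D] {T : ℕ}
    (M : EpisodicMDP S A T) (φ : S × A → D) (Pol : Set (PolicyFn S A T)) (lam δ : ℝ) {Ω : Type*}
    (pol : ℕ → Ω → PolicyFn S A T) (traj : ℕ → Ω → Trajectory S A T)
    (rew : ℕ → Ω → Fin T → ℝ) : Prop :=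
  ∀ k ω, pol k ω ∈ Pol ∧
    IsMaxOn (M.ofulObjective φ lam δ (fun l => latentFreq φ (traj l ω))
      (fun l => ∑ t, rew l ω t) k) Pol (pol k ω)

/-- Regret after `K` episodes in which the policies `p 0, …, p (K-1)` were played. -/
def EpisodicMDP.regret {S A D : Type*} [Fintype S] [Fintype A] [Fintype D] [DecidableEq D]
    {T : ℕ} (M : EpisodicMDP S A T) (φ : S × A → D) (f : D → ℝ) (Pol : Set (PolicyFn S A T))
    (p : ℕ → PolicyFn S A T) (K : ℕ) : ℝ :=
  ∑ k ∈ Finset.range K, (M.optValue Pol - M.latentValue φ f (p k))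

/-- The expression `T n √K log(K T / δ)`. -/
def regretRate (T n K : ℕ) (δ : ℝ) : ℝ :=
  T * n * √(K : ℝ) * Real.log (K * T / δ)

end

open scoped ENNReal NNReal

/-! ### Recursion for the regularized Gram matrices -/

section RegGram

variable {D : Type*} [DecidableEq D]

/-! The value of a policy is linear in its latent occupancy, so the problem is a linear bandit in
dimension `d = |D|`, with one twist: the regression features are the observed frequencies, while the
optimistic bonus is evaluated at the expected occupancies. Two exponential supermartingales, each
controlled at all times by `ville_inequality` at level `10 / δ`, handle the two sources of
randomness.

The first gives the confidence ellipsoid (`selfNormalized_tail`). Given the trajectory, the return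
is a sum of `T` independent variables in `[0,1]`, so its noise is sub-Gaussian with variance proxy
`T/4`. The self-normalized process comes from the method of mixtures, carried out one episode at a
time: by the rank-one update formulas, its multiplicative increment is the integral of `exp (x e -
x² / 2)` over a Gaussian law of `x` with mean `v` and variance `u`, where `v`, `u` depend only on
the past and the current trajectory. Each such tilt has mean at most one, hence so has the
increment.

The second compares occupancies with frequencies (`occupancy_tail`). By Jensen, the squared norm of
the occupancy is at most the conditional mean of the squared norm of the frequency vector. After
division by `T` the latter lies in `[0,1]`, because `λ = T`, and a multiplicative Chernoff argument
bounds the sum of the conditional means by twice the observed sum plus a logarithm. The observed sum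
is bounded by the elliptical potential.

On the intersection of the two events, optimism bounds each regret term by twice the confidence
radius times the norm of the occupancy, and Cauchy–Schwarz over the episodes finishes
(`regret_le_of_good`). The prescribed radius dominates the self-normalized bound only for `d ≥ 2`;
for `d = 1` all policies have the same value and the regret vanishes. -/

theorem regGram_zero (lam : ℝ) (h : ℕ → D → ℝ) : regGram lam h 0 = lam • (1 : Matrix D D ℝ) := by
  ext i j
  simp [regGram]

theorem regGram_succ (lam : ℝ) (h : ℕ → D → ℝ) (k : ℕ) :
    regGram lam h (k + 1) = regGram lam h k + vecMulVec (h k) (h k) := by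
  ext i j
  simp [regGram, Matrix.mul_apply, designMatrix, Fin.sum_univ_castSucc, vecMulVec_apply]
  ring

end RegGram

/-! ### Quadratic forms, rank-one updates and the elliptical potential -/

section LinearAlgebra

variable {D : Type*} [Fintype D]

theorem Matrix.PosSemidef.dotProduct_mulVec_comm {B : Matrix D D ℝ} (hB : B.PosSemidef)
    (x y : D → ℝ) : x ⬝ᵥ B *ᵥ y = y ⬝ᵥ B *ᵥ x := by
  have hT : Bᵀ = B := by simpa using hB.isHermitian.eq
  rw [dotProduct_mulVec, ← mulVec_transpose, hT, dotProduct_comm]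

theorem Matrix.PosSemidef.quadForm_nonneg {B : Matrix D D ℝ} (hB : B.PosSemidef) (x : D → ℝ) :
    0 ≤ x ⬝ᵥ B *ᵥ x := by
  simpa using hB.dotProduct_mulVec_nonneg x

theorem sq_weightedNorm {B : Matrix D D ℝ} (hB : B.PosSemidef) (x : D → ℝ) :
    weightedNorm B x ^ 2 = x ⬝ᵥ B *ᵥ x :=
  Real.sq_sqrt (hB.quadForm_nonneg x)

/-- Cauchy–Schwarz inequality for the semi-inner product of a positive semidefinite matrix. -/
theorem abs_dotProduct_mulVec_le {B : Matrix D D ℝ} (hB : B.PosSemidef) (x y : D → ℝ) :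
    |x ⬝ᵥ B *ᵥ y| ≤ weightedNorm B x * weightedNorm B y := by
  rw [weightedNorm, weightedNorm, ← Real.sqrt_mul (hB.quadForm_nonneg x)]
  apply Real.abs_le_sqrt
  have key : ∀ t : ℝ, 0 ≤ (y ⬝ᵥ B *ᵥ y) * (t * t) + (2 * (x ⬝ᵥ B *ᵥ y)) * t + x ⬝ᵥ B *ᵥ x := by
    intro t
    have h := hB.quadForm_nonneg (x + t • y)
    simp only [mulVec_add, mulVec_smul, dotProduct_add, add_dotProduct, smul_dotProduct,
      dotProduct_smul, smul_eq_mul, hB.dotProduct_mulVec_comm y x] at h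
    linarith
  have h := discrim_le_zero key
  rw [discrim] at h
  nlinarith

theorem sq_dotProduct_le (x y : D → ℝ) : (x ⬝ᵥ y) ^ 2 ≤ (x ⬝ᵥ x) * (y ⬝ᵥ y) := by
  simpa [dotProduct, sq] using Finset.sum_mul_sq_le_sq_mul_sq Finset.univ x y

variable [DecidableEq D]

theorem Matrix.PosDef.mulVec_inv_mulVec {A : Matrix D D ℝ} (hA : A.PosDef) (x : D → ℝ) :
    A *ᵥ A⁻¹ *ᵥ x = x := by
  rw [mulVec_mulVec, mul_nonsing_inv _ ((isUnit_iff_isUnit_det _).1 hA.isUnit), one_mulVec]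

theorem Matrix.PosDef.inv_mulVec_mulVec {A : Matrix D D ℝ} (hA : A.PosDef) (x : D → ℝ) :
    A⁻¹ *ᵥ A *ᵥ x = x := by
  rw [mulVec_mulVec, nonsing_inv_mul _ ((isUnit_iff_isUnit_det _).1 hA.isUnit), one_mulVec]

/-- With `y = A⁻¹ x`, expand `0 ≤ |x - lam y|²` and use `lam |y|² ≤ x ⬝ᵥ y`; no spectral
decomposition is needed. -/
theorem quadForm_inv_le {A : Matrix D D ℝ} (hA : A.PosDef) {lam : ℝ} (hlam : 0 < lam)
    (h : ∀ y : D → ℝ, lam * (y ⬝ᵥ y) ≤ y ⬝ᵥ A *ᵥ y) (x : D → ℝ) :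
    x ⬝ᵥ A⁻¹ *ᵥ x ≤ (x ⬝ᵥ x) / lam := by
  set y := A⁻¹ *ᵥ x with hy
  have hxy : A *ᵥ y = x := hA.mulVec_inv_mulVec x
  have h1 : lam * (y ⬝ᵥ y) ≤ x ⬝ᵥ y := by
    have := h y
    rwa [hxy, dotProduct_comm y x] at this
  have h2 : 0 ≤ (x - lam • y) ⬝ᵥ (x - lam • y) := by
    simpa using dotProduct_star_self_nonneg (x - lam • y)
  simp only [sub_dotProduct, dotProduct_sub, smul_dotProduct, dotProduct_smul, smul_eq_mul,
    dotProduct_comm y x] at h2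
  rw [le_div_iff₀ hlam]
  nlinarith

/-- Effect of a rank-one update of the matrix and of the vector on the inverse quadratic form. -/
theorem quadForm_inv_rankOne {A : Matrix D D ℝ} (hA : A.PosDef) (h s : D → ℝ) (e : ℝ) :
    (s + e • h) ⬝ᵥ (A + vecMulVec h h)⁻¹ *ᵥ (s + e • h) =
      s ⬝ᵥ A⁻¹ *ᵥ s + (2 * (h ⬝ᵥ A⁻¹ *ᵥ s) * e + (h ⬝ᵥ A⁻¹ *ᵥ h) * e ^ 2
        - (h ⬝ᵥ A⁻¹ *ᵥ s) ^ 2) / (1 + h ⬝ᵥ A⁻¹ *ᵥ h) := by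
  have hB := hA.inv.posSemidef
  have hA' : (A + vecMulVec h h).PosDef :=
    hA.add_posSemidef (by simpa using posSemidef_vecMulVec_self_star h)
  have hsym := hB.dotProduct_mulVec_comm s h
  set u := h ⬝ᵥ A⁻¹ *ᵥ h with hu
  set v := h ⬝ᵥ A⁻¹ *ᵥ s with hv
  have hu0 : 0 ≤ u := hB.quadForm_nonneg h
  -- Sherman–Morrison in solved form: the candidate is verified by applying the updated matrix to
  -- it.
  have hsol : (A + vecMulVec h h)⁻¹ *ᵥ (s + e • h)
      = A⁻¹ *ᵥ s + ((e - v) / (1 + u)) • A⁻¹ *ᵥ h := by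
    rw [← hA'.inv_mulVec_mulVec (A⁻¹ *ᵥ s + ((e - v) / (1 + u)) • A⁻¹ *ᵥ h)]
    congr 1
    simp only [add_mulVec, mulVec_add, mulVec_smul, hA.mulVec_inv_mulVec, vecMulVec_mulVec,
      ← hu, ← hv]
    ext z
    simp only [Pi.add_apply, Pi.smul_apply, smul_eq_mul, MulOpposite.smul_eq_mul_unop,
      MulOpposite.unop_op]
    field_simp
    ring
  rw [hsol]
  simp only [dotProduct_add, add_dotProduct, smul_dotProduct, dotProduct_smul, smul_eq_mul, hsym,
    ← hu, ← hv]
  field_simp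
  ring

theorem det_add_vecMulVec {A : Matrix D D ℝ} (hA : A.PosDef) (h : D → ℝ) :
    (A + vecMulVec h h).det = A.det * (1 + h ⬝ᵥ A⁻¹ *ᵥ h) := by
  have := det_add_replicateCol_mul_replicateRow (ι := Unit)
    ((isUnit_iff_isUnit_det _).1 hA.isUnit) h h
  rw [vecMulVec_eq Unit, this]
  congr 1
  rw [det_unique, Matrix.add_apply, one_apply_eq, Matrix.mul_assoc,
    ← replicateCol_mulVec, replicateRow_mul_replicateCol_apply]

/-- The determinant is the product of the eigenvalues, and each of them is the quadratic form at a
unit eigenvector. -/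
theorem det_le_pow {A : Matrix D D ℝ} (hA : A.PosSemidef) {c : ℝ}
    (h : ∀ y : D → ℝ, y ⬝ᵥ A *ᵥ y ≤ c * (y ⬝ᵥ y)) : A.det ≤ c ^ Fintype.card D := by
  rw [hA.isHermitian.det_eq_prod_eigenvalues]
  have : ∀ i ∈ Finset.univ, hA.isHermitian.eigenvalues i ≤ c := by
    intro i _
    set y : D → ℝ := ⇑(hA.isHermitian.eigenvectorBasis i) with hy
    have h1 := hA.isHermitian.mulVec_eigenvectorBasis i
    have h2 := h y
    have h3 : y ⬝ᵥ y = 1 := by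
      have := hA.isHermitian.eigenvectorBasis.orthonormal.1 i
      rw [EuclideanSpace.norm_eq, Real.sqrt_eq_one] at this
      simpa [dotProduct, hy, sq] using this
    rw [hy, h1, dotProduct_smul, ← hy, h3] at h2
    simpa using h2
  simpa using Finset.prod_le_prod (fun i _ => hA.eigenvalues_nonneg i) this

variable (lam : ℝ) (h : ℕ → D → ℝ)

theorem posDef_regGram {lam : ℝ} (hlam : 0 < lam) (k : ℕ) : (regGram lam h k).PosDef := by
  refine PosDef.posSemidef_add ?_ (PosDef.one.smul hlam)
  simpa using posSemidef_conjTranspose_mul_self (designMatrix h k)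

theorem quadForm_regGram (k : ℕ) (y : D → ℝ) :
    y ⬝ᵥ regGram lam h k *ᵥ y = lam * (y ⬝ᵥ y) + ∑ l ∈ Finset.range k, (h l ⬝ᵥ y) ^ 2 := by
  induction k with
  | zero => simp [regGram_zero, smul_mulVec]
  | succ k ih =>
    rw [regGram_succ, add_mulVec, dotProduct_add, ih, Finset.sum_range_succ, vecMulVec_mulVec]
    simp [dotProduct_smul, dotProduct_comm y (h k)]
    ring

theorem quadForm_inv_regGram_le {lam : ℝ} (hlam : 0 < lam) (k : ℕ) (x : D → ℝ) :
    x ⬝ᵥ (regGram lam h k)⁻¹ *ᵥ x ≤ (x ⬝ᵥ x) / lam := by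
  refine quadForm_inv_le (posDef_regGram h hlam k) hlam (fun y => ?_) x
  rw [quadForm_regGram]
  have : 0 ≤ ∑ l ∈ Finset.range k, (h l ⬝ᵥ y) ^ 2 := Finset.sum_nonneg fun _ _ => sq_nonneg _
  linarith

theorem det_regGram_le {lam : ℝ} (hlam : 0 < lam) {c : ℝ} (hc : ∀ l, h l ⬝ᵥ h l ≤ c) (k : ℕ) :
    (regGram lam h k).det ≤ (lam + k * c) ^ Fintype.card D := by
  refine det_le_pow (posDef_regGram h hlam k).posSemidef fun y => ?_
  rw [quadForm_regGram, add_mul]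
  have hy : 0 ≤ y ⬝ᵥ y := by simpa using dotProduct_star_self_nonneg y
  have : ∑ l ∈ Finset.range k, (h l ⬝ᵥ y) ^ 2 ≤ ∑ l ∈ Finset.range k, c * (y ⬝ᵥ y) :=
    Finset.sum_le_sum fun l _ =>
      (sq_dotProduct_le _ _).trans (mul_le_mul_of_nonneg_right (hc l) hy)
  rw [Finset.sum_const, Finset.card_range, nsmul_eq_mul] at this
  linarith

theorem det_regGram_zero : (regGram lam h 0).det = lam ^ Fintype.card D := by
  rw [regGram_zero, det_smul, det_one, mul_one]

/-- Elliptical potential identity. -/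
theorem sum_log_one_add_quadForm {lam : ℝ} (hlam : 0 < lam) (k : ℕ) :
    ∑ l ∈ Finset.range k, Real.log (1 + h l ⬝ᵥ (regGram lam h l)⁻¹ *ᵥ h l)
      = Real.log (regGram lam h k).det - Real.log (regGram lam h 0).det := by
  induction k with
  | zero => simp
  | succ k ih =>
    have hA := posDef_regGram h hlam k
    have := hA.inv.posSemidef.quadForm_nonneg (h k)
    rw [Finset.sum_range_succ, ih, regGram_succ, det_add_vecMulVec hA,
      Real.log_mul hA.det_pos.ne' (by positivity)]
    ring

theorem log_det_regGram_sub_le {lam : ℝ} (hlam : 0 < lam) {c : ℝ} (hc : ∀ l, h l ⬝ᵥ h l ≤ c)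
    (hc0 : 0 ≤ c) (k : ℕ) :
    Real.log (regGram lam h k).det - Real.log (regGram lam h 0).det
      ≤ Fintype.card D * Real.log (1 + k * c / lam) := by
  have h1 : Real.log (regGram lam h k).det ≤ Real.log ((lam + k * c) ^ Fintype.card D) :=
    Real.log_le_log (posDef_regGram h hlam k).det_pos (det_regGram_le h hlam hc k)
  have h2 : 1 + k * c / lam = (lam + k * c) / lam := by field_simp
  rw [det_regGram_zero, h2, Real.log_div (by positivity) hlam.ne', Real.log_pow] at *
  linarith

end LinearAlgebra

/-! ### Maximal inequality, disintegration and sub-Gaussian mixtures -/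

section Probability

/-- The lower integral is superadditive for arbitrary functions, which spares a measurability proof
for the inner integrals in `setLIntegral_mul_le`. -/
theorem sum_lintegral_le {Ω ι : Type*} [MeasurableSpace Ω] (μ : Measure Ω) (s : Finset ι)
    (g : ι → Ω → ℝ≥0∞) : ∑ i ∈ s, ∫⁻ ω, g i ω ∂μ ≤ ∫⁻ ω, ∑ i ∈ s, g i ω ∂μ := by
  classical
  induction s using Finset.induction_on with
  | empty => simp
  | insert i s hi ih =>
    simp_rw [Finset.sum_insert hi]
    exact (add_le_add_right ih _).trans (le_lintegral_add _ _)

/-- **Ville's maximal inequality**, for a process given with its supermartingale property in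
integrated form. -/
theorem ville_inequality {Ω : Type*} {mΩ : MeasurableSpace Ω} {μ : Measure Ω}
    [IsProbabilityMeasure μ] {F : Filtration ℕ mΩ} {N : ℕ → Ω → ℝ≥0∞}
    (hN : ∀ k, Measurable[F k] (N k)) (hN0 : ∀ ω, N 0 ω ≤ 1)
    (hstep : ∀ k (s : Set Ω), MeasurableSet[F k] s →
      ∫⁻ ω in s, N (k + 1) ω ∂μ ≤ ∫⁻ ω in s, N k ω ∂μ) (c : ℝ≥0∞) :
    c * μ {ω | ∃ k, c ≤ N k ω} ≤ 1 := by
  set B : ℕ → Set Ω := fun n => {ω | ∃ k ≤ n, c ≤ N k ω} with hB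
  have hlev : ∀ k, MeasurableSet[F k] {ω | c ≤ N k ω} := fun k =>
    hN k measurableSet_Ici
  have hBsucc : ∀ n, B (n + 1) = B n ∪ {ω | c ≤ N (n + 1) ω} := by
    intro n
    ext ω
    simp only [hB, Set.mem_ofPred_eq, Set.mem_union]
    constructor
    · rintro ⟨k, hk, h⟩
      rcases Nat.le_succ_iff.1 hk with hk | rfl
      · exact Or.inl ⟨k, hk, h⟩
      · exact Or.inr h
    · rintro (⟨k, hk, h⟩ | h)
      · exact ⟨k, hk.trans (Nat.le_succ n), h⟩
      · exact ⟨n + 1, le_rfl, h⟩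
  have hBmeas : ∀ n, MeasurableSet[F n] (B n) := by
    intro n
    induction n with
    | zero => simpa [hB] using hlev 0
    | succ n ih =>
      rw [hBsucc]
      exact MeasurableSet.union (F.mono (Nat.le_succ n) _ ih) (hlev (n + 1))
  -- This is optional stopping at the first crossing of `c`: paths that have crossed contribute at
  -- least `c` each and are frozen, the others still carry `N n`.
  have hmain : ∀ n, c * μ (B n) + ∫⁻ ω in (B n)ᶜ, N n ω ∂μ ≤ 1 := by
    have aux : ∀ n (s t : Set Ω), MeasurableSet t → t ⊆ s → t ⊆ {ω | c ≤ N n ω} →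
        c * μ t + ∫⁻ ω in s \ t, N n ω ∂μ ≤ ∫⁻ ω in s, N n ω ∂μ := by
      intro n s t ht hts htc
      rw [← lintegral_inter_add_sdiff (N n) s ht, Set.inter_eq_right.2 hts]
      gcongr
      rw [← setLIntegral_const]
      exact setLIntegral_mono' ht htc
    intro n
    induction n with
    | zero =>
      have h0 : B 0 = {ω | c ≤ N 0 ω} := by simp [hB]
      have := aux 0 Set.univ (B 0) (F.le 0 _ (hBmeas 0)) (Set.subset_univ _) h0.subset
      rw [← Set.compl_eq_univ_sdiff] at this
      refine this.trans ?_
      calc ∫⁻ ω in Set.univ, N 0 ω ∂μ ≤ ∫⁻ _ in Set.univ, 1 ∂μ := lintegral_mono hN0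
        _ = 1 := by simp
    | succ n ih =>
      set t := {ω | c ≤ N (n + 1) ω} \ B n with ht
      have htm : MeasurableSet t :=
        (F.le _ _ (hlev (n + 1))).diff (F.le _ _ (hBmeas n))
      have h1 := aux (n + 1) (B n)ᶜ t htm (fun ω h => h.2) (fun ω h => h.1)
      have h2 : (B n)ᶜ \ t = (B (n + 1))ᶜ := by
        rw [hBsucc]
        ext ω
        simp only [ht, Set.mem_sdiff, Set.mem_compl_iff, Set.mem_union, not_or]
        tauto
      have h3 : μ (B (n + 1)) = μ (B n) + μ t := by
        rw [hBsucc, ← Set.union_sdiff_self, measure_union Set.disjoint_sdiff_right htm]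
      rw [h2] at h1
      calc c * μ (B (n + 1)) + ∫⁻ ω in (B (n + 1))ᶜ, N (n + 1) ω ∂μ
          = c * μ (B n) + (c * μ t + ∫⁻ ω in (B (n + 1))ᶜ, N (n + 1) ω ∂μ) := by
            rw [h3, mul_add, add_assoc]
        _ ≤ c * μ (B n) + ∫⁻ ω in (B n)ᶜ, N n ω ∂μ := by
            gcongr
            exact h1.trans (hstep n _ (hBmeas n).compl)
        _ ≤ 1 := ih
  have hU : {ω | ∃ k, c ≤ N k ω} = ⋃ n, B n := by
    ext ω
    simp only [hB, Set.mem_ofPred_eq, Set.mem_iUnion]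
    exact ⟨fun ⟨k, h⟩ => ⟨k, k, le_rfl, h⟩, fun ⟨_, k, _, h⟩ => ⟨k, h⟩⟩
  have hmono : Monotone B := fun m n hmn ω ⟨k, hk, h⟩ => ⟨k, hk.trans hmn, h⟩
  rw [hU, hmono.measure_iUnion, ENNReal.mul_iSup]
  exact iSup_le fun n => le_self_add.trans (hmain n)

/-- Disintegration of an integral on an event `s` on which `Y` has, given `X`, the subdensity
`p ∘ X` times the fixed law `π`. -/
theorem setLIntegral_of_forall_rectangle {Ω Ω' E : Type*} [MeasurableSpace Ω] [MeasurableSpace Ω']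
    [MeasurableSpace E] {μ : Measure Ω} [IsProbabilityMeasure μ] {X : Ω → Ω'} {Y : Ω → E}
    (hX : Measurable X) (hY : Measurable Y) {s : Set Ω} {p : Ω' → ℝ≥0∞}
    (hp : Measurable p) {π : Measure E} [IsProbabilityMeasure π]
    (h : ∀ (A : Set Ω') (B : Set E), MeasurableSet A → MeasurableSet B →
      μ (X ⁻¹' A ∩ (s ∩ Y ⁻¹' B)) = (∫⁻ ω in X ⁻¹' A, p (X ω) ∂μ) * π B)
    {G : Ω' × E → ℝ≥0∞} (hG : Measurable G) :
    ∫⁻ ω in s, G (X ω, Y ω) ∂μ = ∫⁻ ω, p (X ω) * ∫⁻ y, G (X ω, y) ∂π ∂μ := by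
  set ν := (μ.map X).withDensity p with hν
  have hνA : ∀ A, MeasurableSet A → ν A = ∫⁻ ω in X ⁻¹' A, p (X ω) ∂μ := by
    intro A hA
    rw [hν, withDensity_apply _ hA, setLIntegral_map hA hp hX]
  have hfin : IsFiniteMeasure ν := by
    refine ⟨?_⟩
    have := h Set.univ Set.univ MeasurableSet.univ MeasurableSet.univ
    rw [← hνA _ MeasurableSet.univ, measure_univ (μ := π), mul_one] at this
    rw [← this]
    exact measure_lt_top _ _
  -- Rectangles determine a product of finite measures, so the hypothesis identifies the joint law
  -- on `s`.
  have hmap : ν.prod π = (μ.restrict s).map fun ω => (X ω, Y ω) := by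
    refine Measure.prod_eq fun A B hA hB => ?_
    rw [Measure.map_apply (hX.prodMk hY) (hA.prod hB),
      Measure.restrict_apply ((hX.prodMk hY) (hA.prod hB)), hνA A hA, ← h A B hA hB]
    congr 1
    ext ω
    simp only [Set.mem_inter_iff, Set.mem_preimage, Set.mem_prod]
    tauto
  rw [← lintegral_map hG (hX.prodMk hY), ← hmap, lintegral_prod _ hG.aemeasurable, hν,
    lintegral_withDensity_eq_lintegral_mul _ hp hG.lintegral_prod_right',
    lintegral_map (hp.mul hG.lintegral_prod_right') hX]
  rfl

/-- Completing the square in `x` turns the integrand into a constant times the Gaussian density with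
mean `(u e + v) / (1 + u)` and variance `u / (1 + u)`. The right side is the increment in
`logSelfNormalized_succ`. -/
theorem lintegral_gaussian_mixture (u v e : ℝ) (hu : 0 < u) :
    ∫⁻ x, ENNReal.ofReal (Real.exp (x * e - x ^ 2 / 2))
        ∂(ProbabilityTheory.gaussianReal v u.toNNReal) =
      ENNReal.ofReal (Real.exp ((2 * v * e + u * e ^ 2 - v ^ 2) / (2 * (1 + u))
        - Real.log (1 + u) / 2)) := by
  have hu' : u.toNNReal ≠ 0 := by simpa using hu
  set w := u / (1 + u) with hw
  have hw0 : 0 < w := by positivity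
  have hw' : w.toNNReal ≠ 0 := by simpa using hw0
  rw [ProbabilityTheory.gaussianReal_of_var_ne_zero _ hu',
    lintegral_withDensity_eq_lintegral_mul _ (ProbabilityTheory.measurable_gaussianPDF _ _)
      (by fun_prop)]
  set K := Real.exp ((2 * v * e + u * e ^ 2 - v ^ 2) / (2 * (1 + u)) - Real.log (1 + u) / 2)
  have hpt : ∀ x, (ProbabilityTheory.gaussianPDF v u.toNNReal
        * fun x => ENNReal.ofReal (Real.exp (x * e - x ^ 2 / 2))) x
      = ENNReal.ofReal K * ProbabilityTheory.gaussianPDF ((u * e + v) / (1 + u)) w.toNNReal x := by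
    intro x
    simp only [Pi.mul_apply, ProbabilityTheory.gaussianPDF]
    rw [← ENNReal.ofReal_mul (ProbabilityTheory.gaussianPDFReal_nonneg _ _ _),
      ← ENNReal.ofReal_mul (Real.exp_pos _).le]
    congr 1
    simp only [ProbabilityTheory.gaussianPDFReal, Real.coe_toNNReal _ hu.le,
      Real.coe_toNNReal _ hw0.le]
    have h1 : √(2 * Real.pi * u) = √(2 * Real.pi * w) * Real.exp (Real.log (1 + u) / 2) := by
      rw [show Real.exp (Real.log (1 + u) / 2) = √(1 + u) by
        rw [Real.sqrt_eq_rpow, Real.rpow_def_of_pos (by positivity)]; ring_nf,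
        ← Real.sqrt_mul (by positivity)]
      congr 1
      rw [hw]; field_simp
    have hs : √(2 * Real.pi * w) ≠ 0 := by positivity
    have h2 : -(x - v) ^ 2 / (2 * u) + (x * e - x ^ 2 / 2)
        = (2 * v * e + u * e ^ 2 - v ^ 2) / (2 * (1 + u))
          + -(x - (u * e + v) / (1 + u)) ^ 2 / (2 * w) := by
      rw [hw]; field_simp; ring
    rw [h1, mul_assoc, ← Real.exp_add, h2, Real.exp_add, Real.exp_sub, mul_inv]
    field_simp
  simp_rw [hpt]
  rw [lintegral_const_mul _ (ProbabilityTheory.measurable_gaussianPDF _ _),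
    ProbabilityTheory.lintegral_gaussianPDF_eq_one _ hw', mul_one]

/-- A standardized sub-Gaussian variable, mixed over a Gaussian tilt. -/
theorem lintegral_exp_quadratic_le_one {E : Type*} [MeasurableSpace E] {π : Measure E}
    [IsProbabilityMeasure π] {e : E → ℝ} (he : Measurable e)
    (hsub : ∀ x : ℝ, ∫⁻ y, ENNReal.ofReal (Real.exp (x * e y)) ∂π
      ≤ ENNReal.ofReal (Real.exp (x ^ 2 / 2)))
    (u v : ℝ) (hu : 0 ≤ u) :
    ∫⁻ y, ENNReal.ofReal (Real.exp ((2 * v * e y + u * e y ^ 2 - v ^ 2) / (2 * (1 + u))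
      - Real.log (1 + u) / 2)) ∂π ≤ 1 := by
  have htilt : ∀ x : ℝ, ∫⁻ y, ENNReal.ofReal (Real.exp (x * e y - x ^ 2 / 2)) ∂π ≤ 1 := by
    intro x
    simp_rw [sub_eq_add_neg, Real.exp_add]
    simp_rw [ENNReal.ofReal_mul (Real.exp_pos _).le]
    rw [lintegral_mul_const _ (by fun_prop)]
    calc _ ≤ ENNReal.ofReal (Real.exp (x ^ 2 / 2)) * ENNReal.ofReal (Real.exp (-(x ^ 2 / 2))) := by
          gcongr; exact hsub x
      _ = 1 := by
          rw [← ENNReal.ofReal_mul (Real.exp_pos _).le, ← Real.exp_add]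
          simp
  -- For `u = 0` the mixing law is a point mass without density, and the claim is the single tilt at
  -- `v`.
  rcases hu.eq_or_lt with rfl | hu
  · refine le_trans (le_of_eq ?_) (htilt v)
    congr 1
    ext y
    congr 2
    simp
    ring
  · simp_rw [← lintegral_gaussian_mixture u v _ hu]
    rw [lintegral_lintegral_swap]
    · calc _ ≤ ∫⁻ _, 1 ∂(ProbabilityTheory.gaussianReal v u.toNNReal) := lintegral_mono htilt
        _ = 1 := by simp
    · exact Measurable.aemeasurable (by fun_prop)

open ProbabilityTheory in
/-- Hoeffding's lemma for the sum of independent variables with values in `[0, 1]`. -/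
theorem lintegral_exp_sum_sub_le {T : ℕ} (ν : Fin T → Measure ℝ)
    [∀ t, IsProbabilityMeasure (ν t)] (hν : ∀ t, ν t (Set.Icc 0 1)ᶜ = 0) (s : ℝ) :
    ∫⁻ y, ENNReal.ofReal (Real.exp (s * (∑ t, y t - ∑ t, ∫ z, z ∂(ν t)))) ∂(Measure.pi ν)
      ≤ ENNReal.ofReal (Real.exp (T * s ^ 2 / 8)) := by
  have hint : ∀ t, ∫ y, y t ∂(Measure.pi ν) = ∫ z, z ∂(ν t) := by
    intro t
    have := integral_map (μ := Measure.pi ν) (φ := Function.eval t) (f := fun z : ℝ => z)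
      (measurable_pi_apply t).aemeasurable (by fun_prop)
    rw [(measurePreserving_eval ν t).map_eq] at this
    exact this.symm
  have hsub : ∀ t, HasSubgaussianMGF (fun y : Fin T → ℝ => y t - ∫ z, z ∂(ν t))
      ((‖(1 : ℝ) - 0‖₊ / 2) ^ 2) (Measure.pi ν) := by
    intro t
    rw [← hint t]
    refine hasSubgaussianMGF_of_mem_Icc (measurable_pi_apply t).aemeasurable ?_
    exact (Measure.quasiMeasurePreserving_eval ν t).ae (mem_ae_iff.2 (hν t))
  have hind : iIndepFun (fun t (y : Fin T → ℝ) => y t - ∫ z, z ∂(ν t)) (Measure.pi ν) :=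
    iIndepFun_pi (X := fun t (z : ℝ) => z - ∫ z, z ∂(ν t)) fun t => by fun_prop
  have hsum := HasSubgaussianMGF.sum_of_iIndepFun hind (s := Finset.univ) fun t _ => hsub t
  simp only [Finset.sum_sub_distrib] at hsum
  rw [← ofReal_integral_eq_lintegral_ofReal (hsum.integrable_exp_mul s)
    (ae_of_all _ fun _ => (Real.exp_pos _).le)]
  refine ENNReal.ofReal_le_ofReal ((hsum.mgf_le s).trans (Real.exp_le_exp.2 (le_of_eq ?_)))
  simp
  ring

end Probability

/-! ### Latent frequency vectors -/

section LatentFreq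

variable {S A D : Type*} {T : ℕ} [DecidableEq D] (φ : S × A → D)

theorem latentFreq_nonneg (x : Trajectory S A T) (z : D) : 0 ≤ latentFreq φ x z :=
  Finset.sum_nonneg fun t _ => by split_ifs <;> norm_num

variable [Fintype D]

theorem dotProduct_latentFreq (f : D → ℝ) (x : Trajectory S A T) :
    f ⬝ᵥ latentFreq φ x = ∑ t, f (φ (x t)) := by
  simp only [dotProduct, latentFreq, Finset.mul_sum]
  rw [Finset.sum_comm]
  simp

theorem sum_latentFreq (x : Trajectory S A T) : ∑ z, latentFreq φ x z = T := by
  simpa [dotProduct] using dotProduct_latentFreq φ 1 x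

theorem latentFreq_dotProduct_self_le (x : Trajectory S A T) :
    latentFreq φ x ⬝ᵥ latentFreq φ x ≤ (T : ℝ) ^ 2 := by
  rw [← sum_latentFreq φ x, sq, dotProduct, Finset.sum_mul]
  exact Finset.sum_le_sum fun z _ => mul_le_mul_of_nonneg_left
    (Finset.single_le_sum (fun z _ => latentFreq_nonneg φ x z) (Finset.mem_univ z))
    (latentFreq_nonneg φ x z)

end LatentFreq

/-! ### Trajectory law, occupancies and the interaction -/

section MDP

variable {S A D : Type*} [Fintype S] [Fintype A] {T : ℕ}

/-- Summing out the last state-action pair leaves the same product for a horizon shorter by one. The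
last state is drawn from `init` if the horizon is one, and from a transition otherwise. -/
theorem sum_prod_chain (init : S → ℝ) (hinit : ∑ s, init s = 1) (trans : S → A → S → ℝ)
    (htrans : ∀ s a, ∑ s', trans s a s' = 1) (T : ℕ) (p : PolicyFn S A T)
    (hp : ∀ t s, ∑ a, p t s a = 1) :
    ∑ x : Trajectory S A T, ∏ t : Fin T,
      (if (t : ℕ) = 0 then init (x t).1
        else trans (x ⟨(t : ℕ) - 1, by omega⟩).1 (x ⟨(t : ℕ) - 1, by omega⟩).2 (x t).1)
      * p t (x t).1 (x t).2 = 1 := by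
  induction T with
  | zero => simp
  | succ n ih =>
    have hlast : ∀ q : S → ℝ, ∑ s, q s = 1 →
        ∑ y : S × A, q y.1 * p (Fin.last n) y.1 y.2 = 1 := by
      intro q hq
      simp_rw [Fintype.sum_prod_type, ← Finset.mul_sum, hp, mul_one, hq]
    rw [← (Fin.snocEquiv fun _ : Fin (n + 1) => S × A).sum_comp, Fintype.sum_prod_type_right]
    rw [← ih (fun t => p t.castSucc) fun t s => hp _ s]
    refine Finset.sum_congr rfl fun x _ => ?_
    have hx : ∀ (y : S × A) (i : ℕ) (hi : i < n),
        (Fin.snoc x y : Fin (n + 1) → S × A) ⟨i, hi.trans (Nat.lt_succ_self n)⟩ = x ⟨i, hi⟩ :=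
      fun y i hi => Fin.snoc_castSucc (α := fun _ => S × A) y x ⟨i, hi⟩
    have hsplit : ∀ y : S × A, (∏ t : Fin (n + 1),
        (if (t : ℕ) = 0 then init ((Fin.snoc x y : Fin (n + 1) → S × A) t).1
          else trans ((Fin.snoc x y : Fin (n + 1) → S × A) ⟨(t : ℕ) - 1, by omega⟩).1
            ((Fin.snoc x y : Fin (n + 1) → S × A) ⟨(t : ℕ) - 1, by omega⟩).2
            ((Fin.snoc x y : Fin (n + 1) → S × A) t).1)
        * p t ((Fin.snoc x y : Fin (n + 1) → S × A) t).1
            ((Fin.snoc x y : Fin (n + 1) → S × A) t).2)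
        = (∏ t : Fin n,
          (if (t : ℕ) = 0 then init (x t).1
            else trans (x ⟨(t : ℕ) - 1, by omega⟩).1 (x ⟨(t : ℕ) - 1, by omega⟩).2 (x t).1)
          * p t.castSucc (x t).1 (x t).2)
          * ((if hn : n = 0 then init else trans (x ⟨n - 1, by omega⟩).1 (x ⟨n - 1, by omega⟩).2)
              y.1 * p (Fin.last n) y.1 y.2) := by
      intro y
      rw [Fin.prod_univ_castSucc]
      congr 1
      · refine Finset.prod_congr rfl fun t _ => ?_
        simp only [Fin.snoc_castSucc, Fin.val_castSucc]
        rw [hx y (t - 1) (by omega)]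
      · simp only [Fin.snoc_last, Fin.val_last]
        split_ifs with hn
        · rfl
        · rw [hx y (n - 1) (by omega)]
    refine (Finset.sum_congr rfl fun y _ => hsplit y).trans ?_
    rw [← Finset.mul_sum, hlast, mul_one]
    split_ifs
    · exact hinit
    · exact htrans _ _

namespace EpisodicMDP

variable (M : EpisodicMDP S A T)

theorem sum_trajProb {p : PolicyFn S A T} (hp : IsPolicy p) : ∑ x, M.trajProb p x = 1 :=
  sum_prod_chain M.init M.init_mem.2 M.trans (fun s a => (M.trans_mem s a).2) T p
    fun t s => (hp t s).2

theorem trajProb_nonneg {p : PolicyFn S A T} (hp : IsPolicy p) (x : Trajectory S A T) :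
    0 ≤ M.trajProb p x := by
  refine Finset.prod_nonneg fun t _ => mul_nonneg ?_ ((hp t _).1 _)
  split_ifs
  · exact M.init_mem.1 _
  · exact (M.trans_mem _ _).1 _

theorem trajProb_le_one {p : PolicyFn S A T} (hp : IsPolicy p) (x : Trajectory S A T) :
    M.trajProb p x ≤ 1 := by
  rw [← M.sum_trajProb hp]
  exact Finset.single_le_sum (fun y _ => M.trajProb_nonneg hp y) (Finset.mem_univ x)

theorem measurable_trajProb (x : Trajectory S A T) : Measurable fun p => M.trajProb p x := by
  unfold trajProb
  refine Finset.measurable_prod _ fun t _ => measurable_const.mul ?_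
  exact (measurable_pi_apply _).comp ((measurable_pi_apply _).comp (measurable_pi_apply t))

theorem reward_mem_Icc (t : Fin T) (x : S × A) : M.reward x ∈ Set.Icc (0 : ℝ) 1 := by
  have := M.rewardLaw_prob t x
  have hae : ∀ᵐ y ∂(M.rewardLaw t x), y ∈ Set.Icc (0 : ℝ) 1 :=
    mem_ae_iff.2 (M.rewardLaw_Icc t x)
  rw [← M.rewardLaw_mean t x]
  have hint : Integrable (fun y : ℝ => y) (M.rewardLaw t x) :=
    Integrable.of_mem_Icc 0 1 measurable_id.aemeasurable hae
  refine ⟨integral_nonneg_of_ae (hae.mono fun y hy => hy.1), ?_⟩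
  calc ∫ y, y ∂(M.rewardLaw t x) ≤ ∫ _, (1 : ℝ) ∂(M.rewardLaw t x) :=
        integral_mono_ae hint (integrable_const _) (hae.mono fun y hy => hy.2)
    _ = 1 := by simp

end EpisodicMDP

section LatentOcc

variable [DecidableEq D] [Fintype D] (φ : S × A → D)

theorem EpisodicMDP.dotProduct_latentOcc (M : EpisodicMDP S A T) (g : D → ℝ)
    (p : PolicyFn S A T) :
    g ⬝ᵥ M.latentOcc φ p = ∑ x, M.trajProb p x * (g ⬝ᵥ latentFreq φ x) := by
  simp only [EpisodicMDP.latentOcc, dotProduct_sum, dotProduct_smul, smul_eq_mul]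

theorem EpisodicMDP.value_eq_latentValue (M : EpisodicMDP S A T) {f : D → ℝ}
    (hf : ∀ x, M.reward x = f (φ x)) (p : PolicyFn S A T) :
    M.value p = M.latentValue φ f p := by
  simp only [EpisodicMDP.value, EpisodicMDP.latentValue, M.dotProduct_latentOcc,
    dotProduct_latentFreq, hf]

/-- Jensen's inequality for the quadratic form at the latent occupancy. -/
theorem EpisodicMDP.quadForm_latentOcc_le (M : EpisodicMDP S A T) {p : PolicyFn S A T}
    (hp : IsPolicy p) {B : Matrix D D ℝ} (hB : B.PosSemidef) :
    M.latentOcc φ p ⬝ᵥ B *ᵥ M.latentOcc φ p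
      ≤ ∑ x, M.trajProb p x * (latentFreq φ x ⬝ᵥ B *ᵥ latentFreq φ x) := by
  set o := M.latentOcc φ p with ho
  have h1 : o ⬝ᵥ B *ᵥ o = ∑ x, M.trajProb p x * (latentFreq φ x ⬝ᵥ B *ᵥ o) := by
    rw [dotProduct_comm]
    simp_rw [dotProduct_comm _ (B *ᵥ o)]
    exact M.dotProduct_latentOcc φ (B *ᵥ o) p
  -- The gap in Jensen's inequality is this variance.
  have h2 : 0 ≤ ∑ x, M.trajProb p x * ((latentFreq φ x - o) ⬝ᵥ B *ᵥ (latentFreq φ x - o)) :=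
    Finset.sum_nonneg fun x _ => mul_nonneg (M.trajProb_nonneg hp x) (hB.quadForm_nonneg _)
  have h3 : ∑ x, M.trajProb p x * ((latentFreq φ x - o) ⬝ᵥ B *ᵥ (latentFreq φ x - o))
      = ∑ x, M.trajProb p x * (latentFreq φ x ⬝ᵥ B *ᵥ latentFreq φ x)
        - 2 * ∑ x, M.trajProb p x * (latentFreq φ x ⬝ᵥ B *ᵥ o)
        + (∑ x, M.trajProb p x) * (o ⬝ᵥ B *ᵥ o) := by
    rw [Finset.mul_sum, Finset.sum_mul, ← Finset.sum_sub_distrib, ← Finset.sum_add_distrib]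
    refine Finset.sum_congr rfl fun x _ => ?_
    simp only [mulVec_sub, dotProduct_sub, sub_dotProduct, hB.dotProduct_mulVec_comm o]
    ring
  rw [h3, ← h1, M.sum_trajProb hp] at h2
  linarith

end LatentOcc

namespace IsInteraction

variable {M : EpisodicMDP S A T} {Ω : Type*} {mΩ : MeasurableSpace Ω} {μ : Measure Ω}
  {F : Filtration ℕ mΩ} {pol : ℕ → Ω → PolicyFn S A T}
  {traj : ℕ → Ω → Trajectory S A T} {rew : ℕ → Ω → Fin T → ℝ}

/-- The past trajectories take finitely many values, so any function of them is measurable; this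
covers matrix inverses and determinants without further argument. -/
theorem measurable_history (hI : IsInteraction M μ F pol traj rew) {k : ℕ} {β : Type*}
    [MeasurableSpace β] (g : (Fin k → Trajectory S A T) → β) :
    Measurable[F k] fun ω => g fun l => traj l ω := by
  let _ : MeasurableSpace (Fin k → Trajectory S A T) := ⊤
  have h : Measurable[F k] fun ω (l : Fin k) => traj l ω := by
    refine @measurable_to_countable' _ _ _ _ (F k) _ fun τ => ?_
    have : (fun ω (l : Fin k) => traj l ω) ⁻¹' {τ} = ⋂ l : Fin k, {ω | traj l ω = τ l} := by
      ext ω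
      simp [funext_iff]
    rw [this]
    exact MeasurableSet.iInter fun l => F.mono (Nat.succ_le_of_lt l.2) _ (hI.traj_meas l (τ l))
  exact measurable_from_top.comp h

variable [IsProbabilityMeasure μ]

/-- The conditional law integrated over an event of the past, in the form required by
`setLIntegral_of_forall_rectangle`. -/
theorem measure_rectangle (hI : IsInteraction M μ F pol traj rew) (k : ℕ) (x : Trajectory S A T)
    {s : Set Ω} (hs : MeasurableSet[F k] s) {B : Set (Fin T → ℝ)} (hB : MeasurableSet B) :
    μ (s ∩ ({ω | traj k ω = x} ∩ rew k ⁻¹' B))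
      = (∫⁻ ω in s, ENNReal.ofReal (M.trajProb (pol k ω) x) ∂μ)
        * (Measure.pi fun t => M.rewardLaw t (x t)) B := by
  have := fun t => M.rewardLaw_prob t (x t)
  have hp : Measurable fun ω => M.trajProb (pol k ω) x :=
    (M.measurable_trajProb x).comp ((hI.pol_meas k).mono (F.le k) le_rfl)
  have hint : Integrable (fun ω => M.trajProb (pol k ω) x) μ :=
    Integrable.of_mem_Icc 0 1 hp.aemeasurable (ae_of_all _ fun ω =>
      ⟨M.trajProb_nonneg (hI.isPolicy k ω) x, M.trajProb_le_one (hI.isPolicy k ω) x⟩)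
  set E := {ω | traj k ω = x ∧ rew k ω ∈ B} with hE
  have hEm : MeasurableSet E :=
    (F.le _ _ (hI.traj_meas k x)).inter (F.le _ _ (hI.rew_meas k hB))
  have h1 := setIntegral_condExp (F.le k)
    ((integrable_const (1 : ℝ)).indicator hEm (μ := μ)) hs
  rw [setIntegral_congr_ae (F.le k _ hs) ((hI.condLaw k x B hB).mono fun ω h _ => h),
    integral_mul_const, setIntegral_indicator hEm, setIntegral_const, smul_eq_mul, mul_one] at h1
  have h2 : s ∩ ({ω | traj k ω = x} ∩ rew k ⁻¹' B) = s ∩ E := rfl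
  rw [h2, ← ENNReal.ofReal_toReal (measure_ne_top μ (s ∩ E))]
  rw [← Measure.real, ← h1, ENNReal.ofReal_mul' measureReal_nonneg,
    ofReal_integral_eq_lintegral_ofReal hint.integrableOn
      (ae_of_all _ fun ω => M.trajProb_nonneg (hI.isPolicy k ω) x), ofReal_measureReal]

theorem lintegral_episode (hI : IsInteraction M μ F pol traj rew) (k : ℕ)
    {G : Ω → Trajectory S A T → (Fin T → ℝ) → ℝ≥0∞}
    (hG : ∀ x, Measurable[(F k).prod inferInstance] fun q : Ω × (Fin T → ℝ) => G q.1 x q.2) :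
    ∫⁻ ω, G ω (traj k ω) (rew k ω) ∂μ
      = ∑ x, ∫⁻ ω, ENNReal.ofReal (M.trajProb (pol k ω) x)
          * ∫⁻ y, G ω x y ∂(Measure.pi fun t => M.rewardLaw t (x t)) ∂μ := by
  classical
  have hrew : Measurable (rew k) := (hI.rew_meas k).mono (F.le _) le_rfl
  have htraj : ∀ x, MeasurableSet {ω | traj k ω = x} := fun x => F.le _ _ (hI.traj_meas k x)
  have hid : @Measurable Ω Ω mΩ (F k) id := measurable_id.mono le_rfl (F.le k)
  have hGm : ∀ x, Measurable fun ω => G ω x (rew k ω) := by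
    intro x
    exact (hG x).comp (@Measurable.prodMk _ mΩ _ _ (F k) _ _ _ hid hrew)
  have h1 : ∀ ω, G ω (traj k ω) (rew k ω)
      = ∑ x, {ω | traj k ω = x}.indicator (fun ω => G ω x (rew k ω)) ω := by
    intro ω
    rw [Finset.sum_eq_single (traj k ω)]
    · simp
    · intro x _ hx
      exact Set.indicator_of_notMem (fun h => hx h.symm) _
    · simp
  simp_rw [h1]
  rw [lintegral_finsetSum _ fun x _ => (hGm x).indicator (htraj x)]
  refine Finset.sum_congr rfl fun x _ => ?_
  have := fun t => M.rewardLaw_prob t (x t)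
  rw [lintegral_indicator (htraj x)]
  have hp : Measurable[F k] fun ω => ENNReal.ofReal (M.trajProb (pol k ω) x) :=
    ENNReal.measurable_ofReal.comp ((M.measurable_trajProb x).comp (hI.pol_meas k))
  -- The past is encoded by the identity, seen as a map from `mΩ` to the coarser σ-algebra `F k`.
  exact @setLIntegral_of_forall_rectangle Ω Ω (Fin T → ℝ) mΩ (F k) _ μ _ id (rew k) hid hrew _ _
    hp _ _ (fun s B hs hB => hI.measure_rectangle k x hs hB) _ (hG x)

/-- Multiplying by a factor with conditional mean at most one gives a supermartingale step. -/
theorem setLIntegral_mul_le (hI : IsInteraction M μ F pol traj rew) (k : ℕ)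
    {N N' : Ω → ℝ≥0∞} (hN : Measurable[F k] N)
    {G : Ω → Trajectory S A T → (Fin T → ℝ) → ℝ≥0∞}
    (hG : ∀ x, Measurable[(F k).prod inferInstance] fun q : Ω × (Fin T → ℝ) => G q.1 x q.2)
    (hN' : ∀ ω, N' ω = N ω * G ω (traj k ω) (rew k ω))
    (hle : ∀ ω, ∑ x, ENNReal.ofReal (M.trajProb (pol k ω) x)
      * ∫⁻ y, G ω x y ∂(Measure.pi fun t => M.rewardLaw t (x t)) ≤ 1)
    {s : Set Ω} (hs : MeasurableSet[F k] s) :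
    ∫⁻ ω in s, N' ω ∂μ ≤ ∫⁻ ω in s, N ω ∂μ := by
  have hNs : Measurable[F k] (s.indicator N) := hN.indicator hs
  have hGω : ∀ ω x, Measurable (G ω x) := fun ω x =>
    (hG x).comp (@measurable_prodMk_left _ _ (F k) _ ω)
  have hfst : @Measurable (Ω × (Fin T → ℝ)) Ω ((F k).prod inferInstance) (F k) Prod.fst :=
    @measurable_fst _ _ (F k) _
  have hmeas : ∀ x, Measurable[(F k).prod inferInstance]
      fun q : Ω × (Fin T → ℝ) => s.indicator N q.1 * G q.1 x q.2 := fun x =>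
    (hNs.comp hfst).mul (hG x)
  rw [← lintegral_indicator (F.le k _ hs), ← lintegral_indicator (F.le k _ hs)]
  calc ∫⁻ ω, s.indicator N' ω ∂μ
      = ∫⁻ ω, s.indicator N ω * G ω (traj k ω) (rew k ω) ∂μ := by
        congr 1
        ext ω
        by_cases h : ω ∈ s <;> simp [h, hN']
    _ = ∑ x, ∫⁻ ω, ENNReal.ofReal (M.trajProb (pol k ω) x)
          * ∫⁻ y, s.indicator N ω * G ω x y ∂(Measure.pi fun t => M.rewardLaw t (x t)) ∂μ :=
        hI.lintegral_episode k (G := fun ω x y => s.indicator N ω * G ω x y) hmeas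
    _ ≤ ∫⁻ ω, ∑ x, ENNReal.ofReal (M.trajProb (pol k ω) x)
          * ∫⁻ y, s.indicator N ω * G ω x y ∂(Measure.pi fun t => M.rewardLaw t (x t)) ∂μ :=
        sum_lintegral_le _ _ _
    _ ≤ ∫⁻ ω, s.indicator N ω ∂μ := by
        refine lintegral_mono fun ω => ?_
        simp_rw [lintegral_const_mul _ (hGω ω _), mul_left_comm _ (s.indicator N ω)]
        rw [← Finset.mul_sum]
        exact mul_le_of_le_one_right' (hle ω)

end IsInteraction

end MDP

/-! ### Self-normalized process and error of the ridge estimate -/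

section SelfNormalized

variable {D : Type*}

/-- The noise-weighted sum of the first `k` feature vectors. -/
def noiseSum (h : ℕ → D → ℝ) (e : ℕ → ℝ) (k : ℕ) : D → ℝ :=
  ∑ l ∈ Finset.range k, e l • h l

theorem noiseSum_succ (h : ℕ → D → ℝ) (e : ℕ → ℝ) (k : ℕ) :
    noiseSum h e (k + 1) = noiseSum h e k + e k • h k :=
  Finset.sum_range_succ _ _

theorem noiseSum_const_mul (h : ℕ → D → ℝ) (e : ℕ → ℝ) (c : ℝ) (k : ℕ) :
    noiseSum h (fun l => c * e l) k = c • noiseSum h e k := by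
  simp only [noiseSum, Finset.smul_sum, smul_smul]

variable [Fintype D] [DecidableEq D]

/-- Logarithm, up to an additive constant, of the self-normalized exponential process of the noise
`e` with features `h`. -/
noncomputable def logSelfNormalized (lam : ℝ) (h : ℕ → D → ℝ) (e : ℕ → ℝ) (k : ℕ) : ℝ :=
  noiseSum h e k ⬝ᵥ (regGram lam h k)⁻¹ *ᵥ noiseSum h e k / 2
    - Real.log (regGram lam h k).det / 2

theorem logSelfNormalized_zero (lam : ℝ) (h : ℕ → D → ℝ) (e : ℕ → ℝ) :
    logSelfNormalized lam h e 0 = -(Real.log (lam ^ Fintype.card D) / 2) := by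
  simp [logSelfNormalized, noiseSum, det_regGram_zero]

theorem logSelfNormalized_succ {lam : ℝ} (hlam : 0 < lam) (h : ℕ → D → ℝ) (e : ℕ → ℝ) (k : ℕ) :
    logSelfNormalized lam h e (k + 1) = logSelfNormalized lam h e k
      + ((2 * (h k ⬝ᵥ (regGram lam h k)⁻¹ *ᵥ noiseSum h e k) * e k
            + (h k ⬝ᵥ (regGram lam h k)⁻¹ *ᵥ h k) * e k ^ 2
            - (h k ⬝ᵥ (regGram lam h k)⁻¹ *ᵥ noiseSum h e k) ^ 2)
          / (2 * (1 + h k ⬝ᵥ (regGram lam h k)⁻¹ *ᵥ h k))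
        - Real.log (1 + h k ⬝ᵥ (regGram lam h k)⁻¹ *ᵥ h k) / 2) := by
  have hA := posDef_regGram h hlam k
  have hu := hA.inv.posSemidef.quadForm_nonneg (h k)
  rw [logSelfNormalized, logSelfNormalized, noiseSum_succ, regGram_succ, quadForm_inv_rankOne hA,
    det_add_vecMulVec hA, Real.log_mul hA.det_pos.ne' (by positivity)]
  field_simp
  ring

theorem regGram_mulVec (lam : ℝ) (h : ℕ → D → ℝ) (k : ℕ) (y : D → ℝ) :
    regGram lam h k *ᵥ y = lam • y + ∑ l ∈ Finset.range k, (y ⬝ᵥ h l) • h l := by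
  induction k with
  | zero => simp [regGram_zero, smul_mulVec]
  | succ k ih =>
    rw [regGram_succ, add_mulVec, ih, Finset.sum_range_succ, vecMulVec_mulVec, add_assoc,
      dotProduct_comm y (h k)]
    simp

/-- Writing `f = A⁻¹ A f` splits the error into the noise and the shrinkage bias `-lam • f`. -/
theorem ridgeEstimate_sub {lam : ℝ} (hlam : 0 < lam) (h : ℕ → D → ℝ) (R : ℕ → ℝ) (f : D → ℝ)
    (k : ℕ) :
    ridgeEstimate lam h R k - f
      = (regGram lam h k)⁻¹ *ᵥ (noiseSum h (fun l => R l - f ⬝ᵥ h l) k - lam • f) := by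
  have hA := posDef_regGram h hlam k
  nth_rewrite 1 [← hA.inv_mulVec_mulVec f]
  rw [ridgeEstimate, ← mulVec_sub, regGram_mulVec]
  congr 1
  simp only [noiseSum, sub_smul, Finset.sum_sub_distrib]
  abel

/-- Confidence bound for the ridge estimate in terms of the self-normalized process. -/
theorem abs_dotProduct_ridgeEstimate_sub_le {lam : ℝ} (hlam : 0 < lam) (h : ℕ → D → ℝ)
    (R : ℕ → ℝ) {f : D → ℝ} (hf : ∀ z, f z ∈ Set.Icc (0 : ℝ) 1) (k : ℕ) (o : D → ℝ) {b : ℝ}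
    (hb : noiseSum h (fun l => R l - f ⬝ᵥ h l) k ⬝ᵥ
      (regGram lam h k)⁻¹ *ᵥ noiseSum h (fun l => R l - f ⬝ᵥ h l) k ≤ b) :
    |o ⬝ᵥ (ridgeEstimate lam h R k - f)|
      ≤ (√b + √(lam * Fintype.card D)) * weightedNorm (regGram lam h k)⁻¹ o := by
  have hB := (posDef_regGram h hlam k).inv.posSemidef
  set s := noiseSum h (fun l => R l - f ⬝ᵥ h l) k
  have hff : f ⬝ᵥ f ≤ Fintype.card D := by
    calc f ⬝ᵥ f ≤ ∑ _ : D, (1 : ℝ) :=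
          Finset.sum_le_sum fun z _ => mul_le_one₀ (hf z).2 (hf z).1 (hf z).2
      _ = Fintype.card D := by simp
  have hfn : lam * weightedNorm (regGram lam h k)⁻¹ f ≤ √(lam * Fintype.card D) := by
    apply Real.le_sqrt_of_sq_le
    rw [mul_pow, sq_weightedNorm hB]
    have := quadForm_inv_regGram_le h hlam k f
    rw [le_div_iff₀ hlam] at this
    nlinarith
  have h0 : 0 ≤ weightedNorm (regGram lam h k)⁻¹ o := Real.sqrt_nonneg _
  have h1 := abs_dotProduct_mulVec_le hB o s
  have h2 := abs_dotProduct_mulVec_le hB o f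
  have h3 : weightedNorm (regGram lam h k)⁻¹ s ≤ √b := Real.sqrt_le_sqrt hb
  rw [ridgeEstimate_sub hlam, mulVec_sub, mulVec_smul, dotProduct_sub, dotProduct_smul, smul_eq_mul]
  calc _ ≤ |o ⬝ᵥ (regGram lam h k)⁻¹ *ᵥ s| + |lam * (o ⬝ᵥ (regGram lam h k)⁻¹ *ᵥ f)| :=
        abs_sub _ _
    _ ≤ weightedNorm (regGram lam h k)⁻¹ o * √b
        + weightedNorm (regGram lam h k)⁻¹ o * (lam * weightedNorm (regGram lam h k)⁻¹ f) := by
        rw [abs_mul, abs_of_pos hlam, mul_left_comm]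
        exact add_le_add (h1.trans (mul_le_mul_of_nonneg_left h3 h0))
          (mul_le_mul_of_nonneg_left h2 hlam.le)
    _ ≤ weightedNorm (regGram lam h k)⁻¹ o * √b
        + weightedNorm (regGram lam h k)⁻¹ o * √(lam * Fintype.card D) := by gcongr
    _ = _ := by ring

end SelfNormalized

/-! ### Measurability with respect to the past -/

section Measurability

theorem measurable_dotProduct_mulVec {Ω D : Type*} [MeasurableSpace Ω] [Fintype D]
    {x y : Ω → D → ℝ} {B : Ω → Matrix D D ℝ} (hx : ∀ i, Measurable fun ω => x ω i)
    (hy : ∀ i, Measurable fun ω => y ω i) (hB : ∀ i j, Measurable fun ω => B ω i j) :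
    Measurable fun ω => x ω ⬝ᵥ B ω *ᵥ y ω := by
  simp only [dotProduct, mulVec]
  exact Finset.measurable_sum _ fun i _ => (hx i).mul
    (Finset.measurable_sum _ fun j _ => (hB i j).mul (hy j))

theorem measurable_exp_quadratic {Ω E : Type*} [MeasurableSpace Ω] [MeasurableSpace E]
    {u v : Ω → ℝ} {e : E → ℝ} (hu : Measurable u) (hv : Measurable v) (he : Measurable e) :
    Measurable fun q : Ω × E => ENNReal.ofReal (Real.exp
      ((2 * v q.1 * e q.2 + u q.1 * e q.2 ^ 2 - v q.1 ^ 2) / (2 * (1 + u q.1))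
        - Real.log (1 + u q.1) / 2)) := by
  fun_prop

end Measurability

namespace IsInteraction

variable {S A D : Type*} [Fintype S] [Fintype A] [DecidableEq D] {T : ℕ}
  {M : EpisodicMDP S A T} {Ω : Type*} {mΩ : MeasurableSpace Ω} {μ : Measure Ω}
  {F : Filtration ℕ mΩ} {pol : ℕ → Ω → PolicyFn S A T}
  {traj : ℕ → Ω → Trajectory S A T} {rew : ℕ → Ω → Fin T → ℝ}

theorem measurable_latentFreq (hI : IsInteraction M μ F pol traj rew) (φ : S × A → D)
    {l k : ℕ} (hlk : l < k) (z : D) : Measurable[F k] fun ω => latentFreq φ (traj l ω) z :=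
  hI.measurable_history (k := k) fun τ => latentFreq φ (τ ⟨l, hlk⟩) z

variable [Fintype D]

theorem measurable_inv_regGram (hI : IsInteraction M μ F pol traj rew) (φ : S × A → D) (lam : ℝ)
    (k : ℕ) (i j : D) :
    Measurable[F k] fun ω => (regGram lam (fun l => latentFreq φ (traj l ω)) k)⁻¹ i j :=
  hI.measurable_history (k := k) fun τ =>
    ((Matrix.of fun l z => latentFreq φ (τ l) z)ᵀ * (Matrix.of fun l z => latentFreq φ (τ l) z)
      + lam • (1 : Matrix D D ℝ))⁻¹ i j

theorem measurable_det_regGram (hI : IsInteraction M μ F pol traj rew) (φ : S × A → D) (lam : ℝ)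
    (k : ℕ) :
    Measurable[F k] fun ω => (regGram lam (fun l => latentFreq φ (traj l ω)) k).det :=
  hI.measurable_history (k := k) fun τ =>
    ((Matrix.of fun l z => latentFreq φ (τ l) z)ᵀ * (Matrix.of fun l z => latentFreq φ (τ l) z)
      + lam • (1 : Matrix D D ℝ)).det

theorem measurable_noiseSum (hI : IsInteraction M μ F pol traj rew) (φ : S × A → D) (f : D → ℝ)
    (c : ℝ) (k : ℕ) (z : D) :
    Measurable[F k] fun ω => noiseSum (fun l => latentFreq φ (traj l ω))
      (fun l => c * (∑ t, rew l ω t - f ⬝ᵥ latentFreq φ (traj l ω))) k z := by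
  simp only [noiseSum, Finset.sum_apply, Pi.smul_apply, smul_eq_mul]
  refine Finset.measurable_sum _ fun l hl => ?_
  have hlk := Finset.mem_range.1 hl
  have hr : Measurable[F k] (rew l) := (hI.rew_meas l).mono (F.mono hlk) le_rfl
  refine Measurable.mul (measurable_const.mul (Measurable.sub ?_ ?_))
    (hI.measurable_latentFreq φ hlk z)
  · exact Finset.measurable_sum _ fun t _ => (measurable_pi_apply t).comp hr
  · exact Finset.measurable_sum _ fun z _ =>
      measurable_const.mul (hI.measurable_latentFreq φ hlk z)

theorem measurable_logSelfNormalized (hI : IsInteraction M μ F pol traj rew) (φ : S × A → D)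
    (f : D → ℝ) (lam c : ℝ) (k : ℕ) :
    Measurable[F k] fun ω => logSelfNormalized lam (fun l => latentFreq φ (traj l ω))
      (fun l => c * (∑ t, rew l ω t - f ⬝ᵥ latentFreq φ (traj l ω))) k :=
  ((@measurable_dotProduct_mulVec Ω D (F k) _ _ _ _ (hI.measurable_noiseSum φ f c k)
    (hI.measurable_noiseSum φ f c k) (hI.measurable_inv_regGram φ lam k)).div_const 2).sub
    ((Real.measurable_log.comp (hI.measurable_det_regGram φ lam k)).div_const 2)

end IsInteraction

/-! ### The two exponential supermartingales -/

namespace IsInteraction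

variable {S A D : Type*} [Fintype S] [Fintype A] {T : ℕ}
  {M : EpisodicMDP S A T} {Ω : Type*} {mΩ : MeasurableSpace Ω} {μ : Measure Ω}
  [IsProbabilityMeasure μ] {F : Filtration ℕ mΩ} {pol : ℕ → Ω → PolicyFn S A T}
  {traj : ℕ → Ω → Trajectory S A T} {rew : ℕ → Ω → Fin T → ℝ}

/-- The current feature vector is not known before the episode, hence the dependence of `u`, `v` on
the trajectory `x`. It does no harm: the mixture bound holds for each fixed `x`, and averaging over
`x` preserves it. -/
theorem exp_quadratic_tail (hI : IsInteraction M μ F pol traj rew) {L : ℕ → Ω → ℝ}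
    {u v : ℕ → Ω → Trajectory S A T → ℝ} {e : Trajectory S A T → (Fin T → ℝ) → ℝ}
    (hLm : ∀ k, Measurable[F k] (L k)) (hum : ∀ k x, Measurable[F k] fun ω => u k ω x)
    (hvm : ∀ k x, Measurable[F k] fun ω => v k ω x) (hem : ∀ x, Measurable (e x))
    (hu : ∀ k ω x, 0 ≤ u k ω x)
    (hsub : ∀ x (s : ℝ), ∫⁻ y, ENNReal.ofReal (Real.exp (s * e x y))
      ∂(Measure.pi fun t => M.rewardLaw t (x t)) ≤ ENNReal.ofReal (Real.exp (s ^ 2 / 2)))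
    (hL0 : ∀ ω, L 0 ω = 0)
    (hL : ∀ k ω, L (k + 1) ω = L k ω
      + ((2 * v k ω (traj k ω) * e (traj k ω) (rew k ω)
            + u k ω (traj k ω) * e (traj k ω) (rew k ω) ^ 2 - v k ω (traj k ω) ^ 2)
          / (2 * (1 + u k ω (traj k ω))) - Real.log (1 + u k ω (traj k ω)) / 2))
    (c : ℝ≥0∞) :
    c * μ {ω | ∃ k, c ≤ ENNReal.ofReal (Real.exp (L k ω))} ≤ 1 := by
  have hNm : ∀ k, Measurable[F k] fun ω => ENNReal.ofReal (Real.exp (L k ω)) := fun k =>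
    ENNReal.measurable_ofReal.comp (Real.measurable_exp.comp (hLm k))
  refine ville_inequality (F := F) hNm (fun ω => by simp [hL0]) (fun k t ht => ?_) c
  refine hI.setLIntegral_mul_le k (G := fun ω x y => ENNReal.ofReal (Real.exp
    ((2 * v k ω x * e x y + u k ω x * e x y ^ 2 - v k ω x ^ 2) / (2 * (1 + u k ω x))
      - Real.log (1 + u k ω x) / 2))) (hNm k) (fun x => ?_) (fun ω => ?_) (fun ω => ?_) ht
  · exact @measurable_exp_quadratic Ω (Fin T → ℝ) (F k) _ (fun ω => u k ω x) (fun ω => v k ω x)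
      (e x) (hum k x) (hvm k x) (hem x)
  · rw [← ENNReal.ofReal_mul (Real.exp_pos _).le, ← Real.exp_add, hL]
  · calc _ ≤ ∑ x, ENNReal.ofReal (M.trajProb (pol k ω) x) * 1 := by
          refine Finset.sum_le_sum fun x _ => ?_
          have := fun t => M.rewardLaw_prob t (x t)
          gcongr
          exact lintegral_exp_quadratic_le_one (hem x) (hsub x) _ _ (hu k ω x)
      _ = 1 := by
          simp_rw [mul_one]
          rw [← ENNReal.ofReal_sum_of_nonneg fun x _ => M.trajProb_nonneg (hI.isPolicy k ω) x,
            M.sum_trajProb (hI.isPolicy k ω), ENNReal.ofReal_one]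

/-- For `X` in `[0,1]` one has `exp (-X) ≤ 1 - X / 2`, so the conditional mean of `exp (w - X)` is
at most `exp w * (1 - w) ≤ 1`. The loss of a factor two in `w` replaces any variance term. -/
theorem exp_sum_sub_tail (hI : IsInteraction M μ F pol traj rew) {w : ℕ → Ω → ℝ}
    {X : ℕ → Ω → Trajectory S A T → ℝ} (hwm : ∀ k, Measurable[F k] (w k))
    (hXm : ∀ k x, Measurable[F k] fun ω => X k ω x)
    (hXtm : ∀ l k, l < k → Measurable[F k] fun ω => X l ω (traj l ω))
    (hX01 : ∀ k ω x, X k ω x ∈ Set.Icc (0 : ℝ) 1)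
    (hw : ∀ k ω, w k ω ≤ ∑ x, M.trajProb (pol k ω) x * X k ω x / 2) (c : ℝ≥0∞) :
    c * μ {ω | ∃ k, c ≤ ENNReal.ofReal (Real.exp
      (∑ l ∈ Finset.range k, (w l ω - X l ω (traj l ω))))} ≤ 1 := by
  have hNm : ∀ k, Measurable[F k] fun ω => ENNReal.ofReal (Real.exp
      (∑ l ∈ Finset.range k, (w l ω - X l ω (traj l ω)))) := fun k =>
    ENNReal.measurable_ofReal.comp (Real.measurable_exp.comp
      (Finset.measurable_sum _ fun l hl =>
        ((hwm l).mono (F.mono (Finset.mem_range.1 hl).le) le_rfl).sub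
          (hXtm l k (Finset.mem_range.1 hl))))
  refine ville_inequality (F := F) hNm (fun ω => by simp) (fun k t ht => ?_) c
  refine hI.setLIntegral_mul_le k (G := fun ω x _ => ENNReal.ofReal (Real.exp (w k ω - X k ω x)))
    (hNm k) (fun x => ?_) (fun ω => ?_) (fun ω => ?_) ht
  · have h1 : Measurable[F k] fun ω => ENNReal.ofReal (Real.exp (w k ω - X k ω x)) :=
      ENNReal.measurable_ofReal.comp (Real.measurable_exp.comp ((hwm k).sub (hXm k x)))
    exact h1.comp (@measurable_fst _ _ (F k) _)
  · rw [← ENNReal.ofReal_mul (Real.exp_pos _).le, ← Real.exp_add, Finset.sum_range_succ]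
  · have hp := hI.isPolicy k ω
    -- It follows from `exp X ≥ 1 + X` and `(1 + X) (1 - X / 2) ≥ 1` on `[0,1]`.
    have hexp : ∀ x, Real.exp (-X k ω x) ≤ 1 - X k ω x / 2 := by
      intro x
      obtain ⟨h0, h1⟩ := hX01 k ω x
      rw [Real.exp_neg, inv_le_comm₀ (Real.exp_pos _) (by linarith)]
      refine le_trans ?_ (Real.add_one_le_exp (X k ω x))
      rw [inv_le_iff_one_le_mul₀ (by linarith)]
      nlinarith
    calc ∑ x, ENNReal.ofReal (M.trajProb (pol k ω) x)
          * ∫⁻ _, ENNReal.ofReal (Real.exp (w k ω - X k ω x))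
            ∂(Measure.pi fun t => M.rewardLaw t (x t))
        = ENNReal.ofReal (∑ x, M.trajProb (pol k ω) x * Real.exp (w k ω - X k ω x)) := by
          rw [ENNReal.ofReal_sum_of_nonneg fun x _ =>
            mul_nonneg (M.trajProb_nonneg hp x) (Real.exp_pos _).le]
          refine Finset.sum_congr rfl fun x _ => ?_
          have := fun t => M.rewardLaw_prob t (x t)
          rw [lintegral_const, measure_univ, mul_one, ENNReal.ofReal_mul (M.trajProb_nonneg hp x)]
      _ ≤ 1 := by
          rw [ENNReal.ofReal_le_one]
          calc ∑ x, M.trajProb (pol k ω) x * Real.exp (w k ω - X k ω x)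
              ≤ ∑ x, Real.exp (w k ω)
                  * (M.trajProb (pol k ω) x - M.trajProb (pol k ω) x * X k ω x / 2) := by
                refine Finset.sum_le_sum fun x _ => ?_
                rw [sub_eq_add_neg, Real.exp_add]
                have := mul_le_mul_of_nonneg_left (hexp x)
                  (mul_nonneg (M.trajProb_nonneg hp x) (Real.exp_pos (w k ω)).le)
                linarith
            _ = Real.exp (w k ω) * (1 - ∑ x, M.trajProb (pol k ω) x * X k ω x / 2) := by
                rw [← Finset.mul_sum, Finset.sum_sub_distrib, M.sum_trajProb hp]
            _ ≤ Real.exp (w k ω) * Real.exp (-w k ω) := by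
                gcongr
                linarith [Real.add_one_le_exp (-w k ω), hw k ω]
            _ = 1 := by rw [← Real.exp_add]; simp

variable [Fintype D] [DecidableEq D]

/-- Anytime self-normalized deviation inequality for the standardized noise of the returns. -/
theorem selfNormalized_tail (hI : IsInteraction M μ F pol traj rew) (hT : 0 < T)
    {φ : S × A → D} {f : D → ℝ} (hf : ∀ x, M.reward x = f (φ x)) {lam : ℝ} (hlam : 0 < lam)
    (c : ℝ≥0∞) :
    c * μ {ω | ∃ k, c ≤ ENNReal.ofReal (Real.exp
      (logSelfNormalized lam (fun l => latentFreq φ (traj l ω))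
        (fun l => 2 / √T * (∑ t, rew l ω t - f ⬝ᵥ latentFreq φ (traj l ω))) k
        + Real.log (lam ^ Fintype.card D) / 2))} ≤ 1 := by
  have hT' : (0 : ℝ) < T := by exact_mod_cast hT
  have hsub : ∀ (x : Trajectory S A T) (s : ℝ), ∫⁻ y, ENNReal.ofReal (Real.exp
      (s * (2 / √T * (∑ t, y t - f ⬝ᵥ latentFreq φ x))))
      ∂(Measure.pi fun t => M.rewardLaw t (x t)) ≤ ENNReal.ofReal (Real.exp (s ^ 2 / 2)) := by
    intro x s
    have := fun t => M.rewardLaw_prob t (x t)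
    have h1 := lintegral_exp_sum_sub_le (fun t => M.rewardLaw t (x t))
      (fun t => M.rewardLaw_Icc t (x t)) (s * (2 / √T))
    -- The variance proxy of the return is `T / 4`, so the factor `2 / √T` normalizes it to one.
    have h2 : (T : ℝ) * (s * (2 / √T)) ^ 2 / 8 = s ^ 2 / 2 := by
      rw [mul_pow, div_pow, Real.sq_sqrt hT'.le]
      field_simp
      norm_num
    simp only [M.rewardLaw_mean, hf, ← dotProduct_latentFreq, h2] at h1
    simpa only [mul_assoc] using h1
  refine hI.exp_quadratic_tail
    (u := fun k ω x => latentFreq φ x ⬝ᵥ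
      (regGram lam (fun l => latentFreq φ (traj l ω)) k)⁻¹ *ᵥ latentFreq φ x)
    (v := fun k ω x => latentFreq φ x ⬝ᵥ
      (regGram lam (fun l => latentFreq φ (traj l ω)) k)⁻¹ *ᵥ
        noiseSum (fun l => latentFreq φ (traj l ω))
          (fun l => 2 / √T * (∑ t, rew l ω t - f ⬝ᵥ latentFreq φ (traj l ω))) k)
    (e := fun x y => 2 / √T * (∑ t, y t - f ⬝ᵥ latentFreq φ x))
    (fun k => (hI.measurable_logSelfNormalized φ f lam _ k).add_const _)
    (fun k x => ?_) (fun k x => ?_) (fun x => by fun_prop) (fun k ω x => ?_) hsub (fun ω => ?_)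
    (fun k ω => ?_) c
  · exact @measurable_dotProduct_mulVec Ω D (F k) _ _ _ _ (fun _ => measurable_const)
      (fun _ => measurable_const) (hI.measurable_inv_regGram φ lam k)
  · exact @measurable_dotProduct_mulVec Ω D (F k) _ _ _ _ (fun _ => measurable_const)
      (hI.measurable_noiseSum φ f _ k) (hI.measurable_inv_regGram φ lam k)
  · exact (posDef_regGram _ hlam k).inv.posSemidef.quadForm_nonneg _
  · rw [logSelfNormalized_zero]
    ring
  · rw [logSelfNormalized_succ hlam]
    ring

/-- Anytime comparison of the occupancies of the played policies with the observed frequencies, in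
the norms of the inverse regularized Gram matrices. -/
theorem occupancy_tail (hI : IsInteraction M μ F pol traj rew) (hT : 0 < T) (φ : S × A → D)
    (c : ℝ≥0∞) :
    c * μ {ω | ∃ k, c ≤ ENNReal.ofReal (Real.exp (∑ l ∈ Finset.range k,
      (M.latentOcc φ (pol l ω) ⬝ᵥ (regGram (T : ℝ) (fun l => latentFreq φ (traj l ω)) l)⁻¹ *ᵥ
          M.latentOcc φ (pol l ω) / T / 2
        - latentFreq φ (traj l ω) ⬝ᵥ (regGram (T : ℝ) (fun l => latentFreq φ (traj l ω)) l)⁻¹ *ᵥ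
          latentFreq φ (traj l ω) / T)))} ≤ 1 := by
  have hT' : (0 : ℝ) < T := by exact_mod_cast hT
  have hBm := hI.measurable_inv_regGram φ T
  have hom : ∀ k z, Measurable[F k] fun ω => M.latentOcc φ (pol k ω) z := by
    intro k z
    simp only [EpisodicMDP.latentOcc, Finset.sum_apply, Pi.smul_apply, smul_eq_mul]
    exact Finset.measurable_sum _ fun x _ =>
      ((M.measurable_trajProb x).comp (hI.pol_meas k)).mul measurable_const
  refine hI.exp_sum_sub_tail
    (w := fun k ω => M.latentOcc φ (pol k ω) ⬝ᵥ
      (regGram (T : ℝ) (fun l => latentFreq φ (traj l ω)) k)⁻¹ *ᵥ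
        M.latentOcc φ (pol k ω) / T / 2)
    (X := fun k ω x => latentFreq φ x ⬝ᵥ
      (regGram (T : ℝ) (fun l => latentFreq φ (traj l ω)) k)⁻¹ *ᵥ latentFreq φ x / T)
    (fun k => ?_) (fun k x => ?_) (fun l k hlk => ?_) (fun k ω x => ⟨?_, ?_⟩) (fun k ω => ?_) c
  · exact ((@measurable_dotProduct_mulVec Ω D (F k) _ _ _ _ (hom k) (hom k)
      (hBm k)).div_const _).div_const _
  · exact (@measurable_dotProduct_mulVec Ω D (F k) _ (fun _ => latentFreq φ x)
      (fun _ => latentFreq φ x) _ (fun _ => measurable_const) (fun _ => measurable_const)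
      (hBm k)).div_const _
  · exact (@measurable_dotProduct_mulVec Ω D (F k) _ _ _ _
      (hI.measurable_latentFreq φ hlk) (hI.measurable_latentFreq φ hlk)
      (fun i j => (hBm l i j).mono (F.mono hlk.le) le_rfl)).div_const _
  · exact div_nonneg ((posDef_regGram _ hT' k).inv.posSemidef.quadForm_nonneg _) hT'.le
  -- The matrix is at least `T • 1` and the squared length of a frequency vector is at most `T²`, so
  -- the quadratic form is at most `T`.
  · rw [div_le_one hT']
    refine (quadForm_inv_regGram_le _ hT' k _).trans ?_
    rw [div_le_iff₀ hT', ← sq]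
    exact latentFreq_dotProduct_self_le φ x
  · have := M.quadForm_latentOcc_le φ (hI.isPolicy k ω)
      (posDef_regGram (fun l => latentFreq φ (traj l ω)) hT' k).inv.posSemidef
    simp_rw [← mul_div_assoc, ← Finset.sum_div]
    gcongr

end IsInteraction

/-! ### Deterministic regret analysis on the good event -/

section Regret

variable {S A D : Type*} [Fintype D] [DecidableEq D] {T : ℕ}

/-- The estimation error of the ridge regression is controlled by the confidence radius, if
the self-normalized noise process stays below the level `10 / δ`. In dimension one the radius would
be too small. -/
theorem abs_dotProduct_ridgeEstimate_sub_le_confRadius (hT : 0 < T) {φ : S × A → D} {f : D → ℝ}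
    (hf : ∀ z, f z ∈ Set.Icc (0 : ℝ) 1) (hD : 2 ≤ Fintype.card D) {δ : ℝ}
    (hδ : δ ∈ Set.Ioo (0 : ℝ) 1) (x : ℕ → Trajectory S A T) (R : ℕ → ℝ) (k : ℕ)
    (hL : logSelfNormalized (T : ℝ) (fun l => latentFreq φ (x l))
      (fun l => 2 / √T * (R l - f ⬝ᵥ latentFreq φ (x l))) k
        + Real.log ((T : ℝ) ^ Fintype.card D) / 2 ≤ Real.log (10 / δ)) (o : D → ℝ) :
    |o ⬝ᵥ (ridgeEstimate (T : ℝ) (fun l => latentFreq φ (x l)) R k - f)|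
      ≤ confRadius T (Fintype.card D) T δ k
        * weightedNorm (regGram (T : ℝ) (fun l => latentFreq φ (x l)) k)⁻¹ o := by
  have hT' : (0 : ℝ) < T := by exact_mod_cast hT
  have hD' : (2 : ℝ) ≤ Fintype.card D := by exact_mod_cast hD
  obtain ⟨hδ0, hδ1⟩ := hδ
  refine abs_dotProduct_ridgeEstimate_sub_le hT' _ R hf k o ?_
  have hdet := log_det_regGram_sub_le (fun l => latentFreq φ (x l)) hT'
    (fun l => latentFreq_dotProduct_self_le φ (x l)) (sq_nonneg (T : ℝ)) k
  rw [det_regGram_zero] at hdet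
  rw [logSelfNormalized, noiseSum_const_mul, mulVec_smul, dotProduct_smul, smul_dotProduct,
    smul_eq_mul, smul_eq_mul, ← mul_assoc, div_mul_div_comm, Real.mul_self_sqrt hT'.le] at hL
  set Q := noiseSum (fun l => latentFreq φ (x l)) (fun l => R l - f ⬝ᵥ latentFreq φ (x l)) k ⬝ᵥ
    (regGram (T : ℝ) (fun l => latentFreq φ (x l)) k)⁻¹ *ᵥ
      noiseSum (fun l => latentFreq φ (x l)) (fun l => R l - f ⬝ᵥ latentFreq φ (x l)) k
  have hlog : 0 ≤ Real.log (10 / δ) :=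
    Real.log_nonneg (by rw [le_div_iff₀ hδ0]; linarith)
  have hpos : 0 < 1 + k * (T : ℝ) ^ 2 / T := by positivity
  have hsplit : Real.log ((1 + k * (T : ℝ) ^ 2 / T) / (δ / 10))
      = Real.log (1 + k * (T : ℝ) ^ 2 / T) + Real.log (10 / δ) := by
    rw [← Real.log_mul hpos.ne' (by positivity)]
    congr 1
    field_simp
  rw [hsplit]
  -- The process yields `d log (1 + k T) + 2 log (10 / δ)`; the radius offers `d` in place of the
  -- `2`, which is where `hD` enters.
  have h1 : 2 * 2 / (T : ℝ) * Q
      ≤ Fintype.card D * (Real.log (1 + k * (T : ℝ) ^ 2 / T) + Real.log (10 / δ)) := by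
    nlinarith
  calc Q = 1 / 4 * T * (2 * 2 / (T : ℝ) * Q) := by field_simp; norm_num
    _ ≤ 1 / 4 * T * (Fintype.card D
          * (Real.log (1 + k * (T : ℝ) ^ 2 / T) + Real.log (10 / δ))) := by gcongr
    _ = _ := by ring

variable [Fintype S] [Fintype A]

/-- Sum of the squared norms of the occupancies of the played policies. -/
theorem sum_sq_weightedNorm_latentOcc_le (hT : 0 < T) (M : EpisodicMDP S A T) (φ : S × A → D)
    (p : ℕ → PolicyFn S A T) (x : ℕ → Trajectory S A T) {b : ℝ} (K : ℕ)
    (hL : ∑ l ∈ Finset.range K,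
      (M.latentOcc φ (p l) ⬝ᵥ (regGram (T : ℝ) (fun l => latentFreq φ (x l)) l)⁻¹ *ᵥ
          M.latentOcc φ (p l) / T / 2
        - latentFreq φ (x l) ⬝ᵥ (regGram (T : ℝ) (fun l => latentFreq φ (x l)) l)⁻¹ *ᵥ
          latentFreq φ (x l) / T) ≤ b) :
    ∑ l ∈ Finset.range K, weightedNorm (regGram (T : ℝ) (fun l => latentFreq φ (x l)) l)⁻¹
        (M.latentOcc φ (p l)) ^ 2
      ≤ 2 * T * (b + 2 * (Fintype.card D * Real.log (1 + K * T))) := by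
  have hT' : (0 : ℝ) < T := by exact_mod_cast hT
  have hT1 : (1 : ℝ) ≤ T := by exact_mod_cast hT
  have hB := fun l => (posDef_regGram (fun l => latentFreq φ (x l)) hT' l).inv.posSemidef
  have hdet := log_det_regGram_sub_le (fun l => latentFreq φ (x l)) hT'
    (fun l => latentFreq_dotProduct_self_le φ (x l)) (sq_nonneg (T : ℝ)) K
  rw [← sum_log_one_add_quadForm _ hT',
    show (K : ℝ) * (T : ℝ) ^ 2 / T = K * T by field_simp] at hdet
  have hu : ∀ l, latentFreq φ (x l) ⬝ᵥ
      (regGram (T : ℝ) (fun l => latentFreq φ (x l)) l)⁻¹ *ᵥ latentFreq φ (x l) / T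
      ≤ 2 * Real.log (1 + latentFreq φ (x l) ⬝ᵥ
        (regGram (T : ℝ) (fun l => latentFreq φ (x l)) l)⁻¹ *ᵥ latentFreq φ (x l)) := by
    intro l
    have h0 := (hB l).quadForm_nonneg (latentFreq φ (x l))
    have h1 : latentFreq φ (x l) ⬝ᵥ
        (regGram (T : ℝ) (fun l => latentFreq φ (x l)) l)⁻¹ *ᵥ latentFreq φ (x l) ≤ T := by
      refine (quadForm_inv_regGram_le _ hT' l _).trans ?_
      rw [div_le_iff₀ hT', ← sq]
      exact latentFreq_dotProduct_self_le φ (x l)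
    set u := latentFreq φ (x l) ⬝ᵥ
      (regGram (T : ℝ) (fun l => latentFreq φ (x l)) l)⁻¹ *ᵥ latentFreq φ (x l)
    have h2 := Real.one_sub_inv_le_log_of_pos (show 0 < 1 + u by positivity)
    -- Since `u ≤ T` and `T ≥ 1`, one has `1 + u ≤ 2 T`.
    have h3 : u / (2 * T) ≤ 1 - (1 + u)⁻¹ := by
      rw [show 1 - (1 + u)⁻¹ = u / (1 + u) by field_simp; ring]
      gcongr
      linarith
    calc u / T = 2 * (u / (2 * T)) := by field_simp
      _ ≤ _ := by linarith
  have hsum := Finset.sum_le_sum fun l (_ : l ∈ Finset.range K) => hu l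
  rw [← Finset.mul_sum] at hsum
  simp_rw [fun l => sq_weightedNorm (hB l)]
  rw [Finset.sum_sub_distrib, ← Finset.sum_div, ← Finset.sum_div] at hL
  have h4 : (∑ l ∈ Finset.range K, M.latentOcc φ (p l) ⬝ᵥ
      (regGram (T : ℝ) (fun l => latentFreq φ (x l)) l)⁻¹ *ᵥ M.latentOcc φ (p l)) / T / 2
      ≤ b + 2 * (Fintype.card D * Real.log (1 + K * T)) := by
    linarith
  rw [div_div, div_le_iff₀ (by positivity)] at h4
  linarith

/-- Numerical estimates for the logarithms in the confidence radius and in the potential. -/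
theorem confRadius_le (hT : 0 < T) (d : ℕ) {δ : ℝ} (hδ : δ ∈ Set.Ioo (0 : ℝ) 1) {k K : ℕ}
    (hk : k < K) (hK : 2 ≤ K * T) :
    confRadius T d T δ k ≤ 3 * √(T * d * Real.log (K * T / δ)) := by
  obtain ⟨hδ0, hδ1⟩ := hδ
  have hT' : (0 : ℝ) < T := by exact_mod_cast hT
  have hK' : (2 : ℝ) ≤ K * T := by exact_mod_cast hK
  -- Only `k < K` episodes have been observed, so the additive one is absorbed by the remaining `T ≥
  -- 1`.
  have hkK : (1 : ℝ) + k * T ≤ K * T := by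
    have h1 : (k : ℝ) + 1 ≤ K := by exact_mod_cast hk
    have h2 : (1 : ℝ) ≤ T := by exact_mod_cast hT
    nlinarith
  set L := Real.log (K * T / δ) with hL
  have hx : (2 : ℝ) ≤ K * T / δ := by
    rw [le_div_iff₀ hδ0]
    nlinarith
  have hL2 : 0.69 ≤ L := by
    have := Real.log_le_log (by norm_num) hx
    linarith [Real.log_two_gt_d9]
  have hlog : Real.log ((1 + k * (T : ℝ) ^ 2 / T) / (δ / 10)) ≤ 5 * L := by
    rw [hL, show (5 : ℝ) = (5 : ℕ) by norm_num, ← Real.log_pow]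
    apply Real.log_le_log (by positivity)
    calc (1 + k * (T : ℝ) ^ 2 / T) / (δ / 10) = 10 * ((1 + k * T) / δ) := by field_simp
      _ ≤ 10 * (K * T / δ) := by gcongr
      _ ≤ 2 ^ 4 * (K * T / δ) := by gcongr; norm_num
      _ ≤ (K * T / δ) ^ 4 * (K * T / δ) := by gcongr
      _ = _ := by ring
  -- Both radicands of the radius fit under `9/4 * T d L`: the first because `5/4 ≤ 9/4`, the second
  -- because `9/4 * 0.69 ≥ 1`.
  have key : ∀ y : ℝ, y ≤ (3 / 2) ^ 2 * (T * d * L) → √y ≤ 3 / 2 * √(T * d * L) := by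
    intro y hy
    rw [← Real.sqrt_sq (show (0 : ℝ) ≤ 3 / 2 by norm_num), ← Real.sqrt_mul (by norm_num)]
    exact Real.sqrt_le_sqrt hy
  have hTd : (0 : ℝ) ≤ T * d := by positivity
  have h1 := key (1 / 4 * T * d * Real.log ((1 + k * (T : ℝ) ^ 2 / T) / (δ / 10)))
    (by nlinarith [mul_le_mul_of_nonneg_left hlog hTd])
  have h2 := key (T * d) (by nlinarith)
  rw [confRadius]
  linarith

/-- With a single latent value every trajectory earns the same true reward, whatever the policy. -/
theorem EpisodicMDP.regret_eq_zero_of_subsingleton [Subsingleton D] {M : EpisodicMDP S A T}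
    {φ : S × A → D} {f : D → ℝ} (hf : ∀ x, M.reward x = f (φ x)) {Pol : Set (PolicyFn S A T)}
    (hPol : ∀ p ∈ Pol, IsPolicy p) {p : ℕ → PolicyFn S A T} (hp : ∀ k, p k ∈ Pol) (z : D)
    (K : ℕ) : M.regret φ f Pol p K = 0 := by
  have hval : ∀ q ∈ Pol, M.latentValue φ f q = T * f z := by
    intro q hq
    rw [EpisodicMDP.latentValue, M.dotProduct_latentOcc]
    simp_rw [dotProduct_latentFreq, fun x => Subsingleton.elim (φ x) z]
    rw [← Finset.sum_mul, M.sum_trajProb (hPol q hq)]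
    simp
  have hopt : M.optValue Pol = T * f z := by
    have : M.value '' Pol = {(T * f z : ℝ)} := by
      refine Set.eq_singleton_iff_nonempty_unique_mem.2 ⟨⟨_, p 0, hp 0, rfl⟩, ?_⟩
      rintro _ ⟨q, hq, rfl⟩
      rw [M.value_eq_latentValue φ hf, hval q hq]
    rw [EpisodicMDP.optValue, this, csSup_singleton]
  refine Finset.sum_eq_zero fun k _ => ?_
  rw [hopt, hval _ (hp k), sub_self]

/-- Regret bound on the event on which both exponential processes stay below `10 / δ`. -/
theorem EpisodicMDP.regret_le_of_good {M : EpisodicMDP S A T} (hT : 0 < T) {φ : S × A → D}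
    {f : D → ℝ} (hf : ∀ x, M.reward x = f (φ x)) (hf01 : ∀ z, f z ∈ Set.Icc (0 : ℝ) 1)
    (hD : 2 ≤ Fintype.card D) {Pol : Set (PolicyFn S A T)} {δ : ℝ} (hδ : δ ∈ Set.Ioo (0 : ℝ) 1)
    {p : ℕ → PolicyFn S A T} {x : ℕ → Trajectory S A T} {R : ℕ → ℝ}
    (hp : ∀ k, p k ∈ Pol ∧
      IsMaxOn (M.ofulObjective φ T δ (fun l => latentFreq φ (x l)) R k) Pol (p k))
    (h1 : ∀ k, logSelfNormalized (T : ℝ) (fun l => latentFreq φ (x l))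
      (fun l => 2 / √T * (R l - f ⬝ᵥ latentFreq φ (x l))) k
        + Real.log ((T : ℝ) ^ Fintype.card D) / 2 ≤ Real.log (10 / δ))
    (h2 : ∀ k, ∑ l ∈ Finset.range k,
      (M.latentOcc φ (p l) ⬝ᵥ (regGram (T : ℝ) (fun l => latentFreq φ (x l)) l)⁻¹ *ᵥ
          M.latentOcc φ (p l) / T / 2
        - latentFreq φ (x l) ⬝ᵥ (regGram (T : ℝ) (fun l => latentFreq φ (x l)) l)⁻¹ *ᵥ
          latentFreq φ (x l) / T) ≤ Real.log (10 / δ))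
    {K : ℕ} (hK : 2 ≤ K * T) :
    M.regret φ f Pol p K ≤ 24 * regretRate T (Fintype.card D) K δ := by
  have hT' : (0 : ℝ) < T := by exact_mod_cast hT
  have hD' : (2 : ℝ) ≤ Fintype.card D := by exact_mod_cast hD
  have hK' : (2 : ℝ) ≤ K * T := by exact_mod_cast hK
  have hδ' := hδ
  obtain ⟨hδ0, hδ1⟩ := hδ'
  set d := Fintype.card D with hd
  set L := Real.log (K * T / δ) with hL
  set n : ℕ → ℝ := fun k => weightedNorm (regGram (T : ℝ) (fun l => latentFreq φ (x l)) k)⁻¹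
    (M.latentOcc φ (p k)) with hn
  have hn0 : ∀ k, 0 ≤ n k := fun k => Real.sqrt_nonneg _
  have hx : (2 : ℝ) ≤ K * T / δ := by
    rw [le_div_iff₀ hδ0]
    nlinarith
  have hL0 : 0 < L := Real.log_pos (by linarith)
  have hKT : (K : ℝ) * T ≤ K * T / δ := by
    rw [le_div_iff₀ hδ0]
    nlinarith
  have hlog10 : Real.log (10 / δ) ≤ 4 * L := by
    rw [hL, show (4 : ℝ) = (4 : ℕ) by norm_num, ← Real.log_pow]
    apply Real.log_le_log (by positivity)
    calc 10 / δ ≤ 2 ^ 3 * (2 / δ) := by rw [← mul_div_assoc]; gcongr; norm_num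
      _ ≤ (K * T / δ) ^ 3 * (K * T / δ) := by gcongr
      _ = _ := by ring
  have hlogK : Real.log (1 + K * T) ≤ 2 * L := by
    rw [hL, show (2 : ℝ) = (2 : ℕ) by norm_num, ← Real.log_pow]
    apply Real.log_le_log (by positivity)
    nlinarith
  -- The factor is `6 = 2 * 3`: the radius is paid once for optimism and once for the played policy,
  -- and it is at most `3 √(T d L)`.
  have hgap : ∀ k ∈ Finset.range K, M.optValue Pol - M.latentValue φ f (p k)
      ≤ 6 * √(T * d * L) * n k := by
    intro k hk
    have hconf := abs_dotProduct_ridgeEstimate_sub_le_confRadius hT hf01 hD hδ x R k (h1 k)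
    -- Every competitor's value lies below its own objective, hence below the maximum; the supremum
    -- need not be attained.
    have hopt : M.optValue Pol
        ≤ M.ofulObjective φ T δ (fun l => latentFreq φ (x l)) R k (p k) := by
      refine csSup_le ⟨_, p k, (hp k).1, rfl⟩ ?_
      rintro _ ⟨q, hq, rfl⟩
      refine le_trans ?_ ((hp k).2 hq)
      have := (abs_le.1 (hconf (M.latentOcc φ q))).1
      rw [dotProduct_sub] at this
      rw [M.value_eq_latentValue φ hf, EpisodicMDP.latentValue, EpisodicMDP.ofulObjective,
        dotProduct_comm f]
      linarith
    have hup := (abs_le.1 (hconf (M.latentOcc φ (p k)))).2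
    have hrad := mul_le_mul_of_nonneg_right
      (confRadius_le hT d hδ (Finset.mem_range.1 hk) hK) (hn0 k)
    rw [dotProduct_sub] at hup
    rw [EpisodicMDP.ofulObjective] at hopt
    rw [EpisodicMDP.latentValue, dotProduct_comm f]
    linarith
  have hsq : ∑ k ∈ Finset.range K, n k ^ 2 ≤ 16 * (T * d * L) := by
    refine (sum_sq_weightedNorm_latentOcc_le hT M φ p x K (h2 K)).trans ?_
    have h3 : Real.log (10 / δ) + 2 * (d * Real.log (1 + K * T)) ≤ 8 * (d * L) := by nlinarith
    nlinarith
  -- Cauchy–Schwarz over the episodes; the `4` is the root of the `16` in `hsq`.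
  have hsum : ∑ k ∈ Finset.range K, n k ≤ √K * (4 * √(T * d * L)) := by
    have h3 : (∑ k ∈ Finset.range K, n k) ^ 2 ≤ K * ∑ k ∈ Finset.range K, n k ^ 2 := by
      simpa using sq_sum_le_card_mul_sum_sq (s := Finset.range K) (f := n)
    refine (sq_le_sq₀ (Finset.sum_nonneg fun k _ => hn0 k) (by positivity)).1 ?_
    rw [mul_pow, mul_pow, Real.sq_sqrt (by positivity), Real.sq_sqrt (by positivity)]
    refine h3.trans ?_
    norm_num
    gcongr
  calc M.regret φ f Pol p K ≤ ∑ k ∈ Finset.range K, 6 * √(T * d * L) * n k :=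
        Finset.sum_le_sum hgap
    _ = 6 * √(T * d * L) * ∑ k ∈ Finset.range K, n k := by rw [Finset.mul_sum]
    _ ≤ 6 * √(T * d * L) * (√K * (4 * √(T * d * L))) := by gcongr
    _ = 24 * √K * (√(T * d * L) * √(T * d * L)) := by ring
    _ = 24 * regretRate T d K δ := by
        rw [Real.mul_self_sqrt (by positivity), regretRate]
        ring

theorem regretRate_lt_regretRate {m n : ℕ} (hmn : m < n) {δ : ℝ} (hδ : δ ∈ Set.Ioo (0 : ℝ) 1)
    {K : ℕ} (hK : 2 ≤ K * T) : regretRate T m K δ < regretRate T n K δ := by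
  obtain ⟨hδ0, hδ1⟩ := hδ
  have hK' : (2 : ℝ) ≤ K * T := by exact_mod_cast hK
  have hT : 0 < T := Nat.pos_of_ne_zero (by rintro rfl; simp at hK)
  have hK0 : 0 < K := Nat.pos_of_ne_zero (by rintro rfl; simp at hK)
  have hL : 0 < Real.log (K * T / δ) := by
    apply Real.log_pos
    rw [lt_div_iff₀ hδ0]
    linarith
  rw [regretRate, regretRate]
  gcongr

/-- A process whose tail at level `10 / δ` is controlled by a maximal inequality. -/
theorem measure_exists_lt_le {Ω : Type*} [MeasurableSpace Ω] {μ : Measure Ω} {L : ℕ → Ω → ℝ}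
    {δ : ℝ} (hδ : 0 < δ)
    (h : ENNReal.ofReal (10 / δ)
      * μ {ω | ∃ k, ENNReal.ofReal (10 / δ) ≤ ENNReal.ofReal (Real.exp (L k ω))} ≤ 1) :
    μ {ω | ∃ k, Real.log (10 / δ) < L k ω} ≤ ENNReal.ofReal (δ / 10) := by
  have hpos : 0 < 10 / δ := by positivity
  have hsub : {ω | ∃ k, Real.log (10 / δ) < L k ω}
      ⊆ {ω | ∃ k, ENNReal.ofReal (10 / δ) ≤ ENNReal.ofReal (Real.exp (L k ω))} := by
    rintro ω ⟨k, hk⟩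
    exact ⟨k, ENNReal.ofReal_le_ofReal ((Real.log_le_iff_le_exp hpos).1 hk.le)⟩
  refine (measure_mono hsub).trans ?_
  rw [show δ / 10 = (10 / δ)⁻¹ by rw [inv_div], ENNReal.ofReal_inv_of_pos hpos,
    ENNReal.le_inv_iff_mul_le, mul_comm]
  exact h

end Regret

/-! ### Assembly: union bound and degenerate cases -/

theorem proposition2 :
    ∃ C : ℝ, 0 < C ∧
      ∀ (S A D : Type*) [Fintype S] [Fintype A] [Fintype D] [DecidableEq D] (T : ℕ)
        (M : EpisodicMDP S A T)
        (φ : S × A → D) (_ : Function.Surjective φ)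
        (f : D → ℝ) (_ : ∀ x, M.reward x = f (φ x))
        (Pol : Set (PolicyFn S A T)) (_ : ∀ p ∈ Pol, IsPolicy p)
        (δ : ℝ) (_ : δ ∈ Set.Ioo (0 : ℝ) 1)
        (Ω : Type*) (mΩ : MeasurableSpace Ω) (μ : Measure Ω) [IsProbabilityMeasure μ]
        (F : Filtration ℕ mΩ)
        (pol : ℕ → Ω → PolicyFn S A T) (traj : ℕ → Ω → Trajectory S A T)
        (rew : ℕ → Ω → Fin T → ℝ)
        (_ : IsInteraction M μ F pol traj rew)
        (_ : IsOFUL M φ Pol (T : ℝ) δ pol traj rew),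
        1 - δ < μ.real {ω | ∀ K : ℕ, 2 ≤ K * T →
            M.regret φ f Pol (fun k => pol k ω) K ≤ C * regretRate T (Fintype.card D) K δ} ∧
        (Fintype.card D < Fintype.card S * Fintype.card A → ∀ K : ℕ, 2 ≤ K * T →
            C * regretRate T (Fintype.card D) K δ
              < C * regretRate T (Fintype.card S * Fintype.card A) K δ) := by
  refine ⟨24, by norm_num, ?_⟩
  intro S A D _ _ _ _ T M φ hφ f hf Pol hPol δ hδ Ω mΩ μ _ F pol traj rew hI hO
  refine ⟨?_, fun hcard K hK => mul_lt_mul_of_pos_left (regretRate_lt_regretRate hcard hδ hK)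
    (by norm_num)⟩
  set good := {ω | ∀ K : ℕ, 2 ≤ K * T →
    M.regret φ f Pol (fun k => pol k ω) K ≤ 24 * regretRate T (Fintype.card D) K δ} with hgood
  -- Total failure probability `δ / 5 < δ` makes the inequality strict. Subadditivity alone is used,
  -- so `good` need not be shown measurable.
  suffices hbad : μ goodᶜ ≤ ENNReal.ofReal (δ / 10) + ENNReal.ofReal (δ / 10) by
    have h1 : (1 : ℝ≥0∞) ≤ μ good + μ goodᶜ := by
      rw [← measure_univ (μ := μ), ← Set.union_compl_self good]
      exact measure_union_le _ _
    have h2 : (1 : ℝ) ≤ μ.real good + μ.real goodᶜ := by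
      rw [Measure.real, Measure.real, ← ENNReal.toReal_add (measure_ne_top _ _)
        (measure_ne_top _ _)]
      simpa using ENNReal.toReal_mono (by simp) h1
    have h3 : μ.real goodᶜ ≤ δ / 10 + δ / 10 := by
      rw [← ENNReal.ofReal_add (by linarith [hδ.1]) (by linarith [hδ.1])] at hbad
      exact ENNReal.toReal_le_of_le_ofReal (by linarith [hδ.1]) hbad
    linarith [hδ.1]
  rcases Nat.eq_zero_or_pos T with rfl | hT
  · have : goodᶜ = ∅ := by
      rw [Set.compl_empty_iff, Set.eq_univ_iff_forall]
      intro ω K hK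
      simp at hK
    simp [this]
  rcases Nat.lt_or_ge (Fintype.card D) 2 with hD | hD
  · have : Subsingleton D := Fintype.card_le_one_iff_subsingleton.1 (by omega)
    have : goodᶜ = ∅ := by
      rw [Set.compl_empty_iff, Set.eq_univ_iff_forall]
      intro ω K hK
      rw [EpisodicMDP.regret_eq_zero_of_subsingleton hf hPol (fun k => (hO k ω).1)
        (φ (traj 0 ω ⟨0, hT⟩)) K]
      have h0 : 0 ≤ Real.log (K * T / δ) := by
        have hK' : (2 : ℝ) ≤ K * T := by exact_mod_cast hK
        apply Real.log_nonneg
        rw [le_div_iff₀ hδ.1]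
        linarith [hδ.2]
      rw [regretRate]
      positivity
    simp [this]
  have hT' : (0 : ℝ) < T := by exact_mod_cast hT
  -- Surjectivity of `φ` makes every value of `f` the mean of a reward in `[0,1]`; this bounds the
  -- shrinkage bias.
  have hf01 : ∀ z, f z ∈ Set.Icc (0 : ℝ) 1 := by
    intro z
    obtain ⟨y, rfl⟩ := hφ z
    rw [← hf]
    exact M.reward_mem_Icc ⟨0, hT⟩ y
  have hA := measure_exists_lt_le hδ.1 (hI.selfNormalized_tail hT hf hT' _)
  have hB := measure_exists_lt_le hδ.1 (hI.occupancy_tail hT φ _)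
  refine (measure_mono ?_).trans ((measure_union_le _ _).trans (add_le_add hA hB))
  intro ω hω
  by_contra hnot
  simp only [Set.mem_union, Set.mem_ofPred_eq, not_or, not_exists, not_lt] at hnot
  exact hω fun K hK => EpisodicMDP.regret_le_of_good hT hf hf01 hD hδ (fun k => hO k ω)
    hnot.1 hnot.2 hK
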